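/- Let $P$ be a convex polygon with $n\ge 3$ vertices $v_1,\dots,v_n$ in clockwise order (indices modulo $n$), no three of them collinear; $P$ includes its interior. For a vertex $A=v_i$ write $A\pm1=v_{i\pm1}$, and let $e_i$ be the vector from $v_i$ to $v_{i+1}$. Triangles $\triangle ABC$ are written with their corners in clockwise order. The corner $A$ of $\triangle ABC$ is *stable* if it has the largest distance to the line $\overleftrightarrow{BC}$ among all points of $P$ on the right of $\overrightarrow{BC}$; stability of $B$ and of $C$ is defined cyclically. A triangle is *3-stable* if its corners are vertices of $P$ and all three are stable. A pair of vertices $(v_j,v_k)$ is *dead* if there is no vertex $v_i$ such that $v_i,v_j,v_k$, in this clockwise order, form a 3-stable triangle. For $B=v_j\ne C=v_k$ let $I_{B,C}$ be the intersection point of the ray from $v_j$ in direction $e_k$ and the ray from $v_k$ in direction $-e_j$; if the rays do not meet, $I_{B,C}$ is at infinity, at infinite distance from $\overleftrightarrow{BC}$. Let $\triangle v_rv_sv_t$ be 3-stable. The *Rotate-and-Kill process* starts with $(A,B,C)=(v_r,v_s,v_t)$ and repeats the following iteration. 1. While $A+1$ is further than $A$ from $\overleftrightarrow{BC}$, replace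 $A$ by $A+1$. 2. Output $\triangle ABC$ if it is 3-stable; output $\triangle (A+1)BC$ if it is 3-stable. 3. If $(B,C)=(v_t,v_r)$, stop. 4. If $A$ is further than $I_{B,C}$ from $\overleftrightarrow{BC}$, *kill* $C$ (replace $C$ by $C+1$); otherwise *kill* $B$ (replace $B$ by $B+1$). Then the following hold. 1. Whenever $B$ is about to be killed, all the pairs $(B,C+1),(B,C+2),\dots,(B,v_r)$ are dead (no pairs if $C=v_r$). 2. Whenever $C$ is about to be killed, all the pairs $(B+1,C),(B+2,C),\dots,(v_t,C)$ are dead (no pairs if $B=v_t$). 3. Throughout the process $B\in\{v_s,v_{s+1},\dots,v_t\}$, $C\in\{v_t,v_{t+1},\dots,v_r\}$ and $B\ne C$; the process reaches $(B,C)=(v_t,v_r)$ and stops there. 4. The triangles output are exactly the 3-stable triangles (each up to cyclic rotation of its corners). Moreover, at the moment when $(B,C)$ becomes $(v_t,v_r)$, every 3-stable triangle has already been output, with the possible exception of $\triangle v_{s-1}v_tv_r$. 5. The process takes $O(n)$ time. Precisely, carry out its tests by real arithmetic on the vertex coordinates: compare distances to a line by comparing triangle areas, test 3-stability by checking the orientation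 and comparing each corner with its two neighbouring vertices, and test $A$ against $I_{B,C}$ by cross products. This implementation goes through the same configurations as the process, and there is a constant $c$, independent of $n$, $P$, $r$, $s$, $t$, such that until it stops it makes at most $cn$ steps (tests for moving $A$, reports, stopping tests, decisions and kills) and at most $cn$ elementary operations (reading a coordinate, a subtraction, multiplication or comparison of reals, moving or comparing a pointer, an output). -/

import Mathlib

namespace RotateAndKill

/-! ## Convex polygons and 3-stable triangles -/

/-- Points (and vectors) of the Euclidean plane. -/
abbrev Pt : Type := EuclideanSpace ℝ (Fin 2)

/-- The two-dimensional cross product. It is negative iff `w` points to the right of `u`. -/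
def cross (u w : Pt) : ℝ := u 0 * w 1 - u 1 * w 0

/-- The open half-plane on the right of the directed line from `B` to `C`. -/
def rightOf (B C : Pt) : Set Pt := {X | cross (C - B) (X - B) < 0}

/-- The distance of `X` to the line through `B` and `C`. -/
noncomputable def lineDist (B C X : Pt) : ℝ :=
  Metric.infDist X (line[ℝ, B, C] : Set Pt)

/-- The closed ray with origin `o` and direction `d`. -/
def ray (o d : Pt) : Set Pt := {X | ∃ a : ℝ, 0 ≤ a ∧ X = o + a • d}

/-- A convex polygon with `n ≥ 3` vertices, no three of them collinear, given by the clockwise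
cyclic enumeration of its vertices: three vertices that come in the cyclic order `i, j, k` form a
clockwise triangle. Indices are taken modulo `n`. -/
structure ConvexPolygon (n : ℕ) where
  three_le : 3 ≤ n
  vertex : ZMod n → Pt
  clockwise : ∀ i j k : ZMod n, 0 < (j - i).val → (j - i).val < (k - i).val →
    cross (vertex j - vertex i) (vertex k - vertex i) < 0

/-- The vertices `i, i + 1, …, j`, clockwise from `i` to `j`, both ends included. -/
def arc {n : ℕ} (i j : ZMod n) : Set (ZMod n) := {k | (k - i).val ≤ (j - i).val}

namespace ConvexPolygon

variable {n : ℕ} (P : ConvexPolygon n)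

/-- The polygon as a closed region of the plane. -/
def region : Set Pt := convexHull ℝ (Set.range P.vertex)

/-- The direction of the `i`-th edge, from vertex `i` to vertex `i + 1`. -/
noncomputable def edge (i : ZMod n) : Pt := P.vertex (i + 1) - P.vertex i

/-- The corner `A` of the triangle `ABC` (with `A` on the right of `BC`) is stable: no point of the
polygon on the right of `BC` is further from the line `BC`. -/
def Stable (A B C : Pt) : Prop :=
  A ∈ rightOf B C ∧ ∀ X ∈ P.region, X ∈ rightOf B C → lineDist B C X ≤ lineDist B C A

/-- The vertices `i, j, k`, in this clockwise order, form a 3-stable triangle. -/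
def ThreeStable (i j k : ZMod n) : Prop :=
  P.Stable (P.vertex i) (P.vertex j) (P.vertex k) ∧
  P.Stable (P.vertex j) (P.vertex k) (P.vertex i) ∧
  P.Stable (P.vertex k) (P.vertex i) (P.vertex j)

/-- The pair `(j, k)` is dead: there is no `i` such that `i, j, k`, in this clockwise order, form a
3-stable triangle. -/
def Dead (j k : ZMod n) : Prop := ¬ ∃ i, P.ThreeStable i j k

/-- The intersection of the ray from vertex `j` in the direction of edge `k` and the ray from
vertex `k` in the direction opposite to edge `j`. For `j ≠ k` it has at most one point `I`; when
it is empty, `I` is at infinity. -/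
def pointI (j k : ZMod n) : Set Pt :=
  ray (P.vertex j) (P.edge k) ∩ ray (P.vertex k) (-P.edge j)

/-- Vertex `X` is further than vertex `Y` in the distance to the line `BC`. -/
def Farther (B C X Y : ZMod n) : Prop :=
  lineDist (P.vertex B) (P.vertex C) (P.vertex Y) <
    lineDist (P.vertex B) (P.vertex C) (P.vertex X)

/-- Vertex `A` is further than the point `I` of the pair `(B, C)` in the distance to the line `BC`;
this is false when `I` is at infinity. -/
def BeyondI (A B C : ZMod n) : Prop :=
  ∃ I ∈ P.pointI B C, lineDist (P.vertex B) (P.vertex C) I <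
    lineDist (P.vertex B) (P.vertex C) (P.vertex A)

end ConvexPolygon

/-! ## Computations that count their elementary operations -/

/-- A value together with the number of elementary operations spent on computing it. -/
structure Timed (α : Type) where
  val : α
  time : ℕ

instance : Monad Timed where
  pure a := ⟨a, 0⟩
  bind x f := ⟨(f x.val).val, x.time + (f x.val).time⟩

/-- One elementary operation with result `a`. -/
def tick {α : Type} (a : α) : Timed α := ⟨a, 1⟩

/-! ## The Rotate-and-Kill process

The process is parametrized by the way in which its three kinds of tests are carried out. -/

/-- The tests of the process. -/
structure Tests (n : ℕ) where
  /-- `farther B C X Y`: is `X` further than `Y` in the distance to the line `BC`? -/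
  farther : ZMod n → ZMod n → ZMod n → ZMod n → Timed Bool
  /-- `threeStable A B C`: is the triangle `ABC` 3-stable? -/
  threeStable : ZMod n → ZMod n → ZMod n → Timed Bool
  /-- `beyondI A B C`: is `A` further than the point `I` of `(B, C)` from the line `BC`? -/
  beyondI : ZMod n → ZMod n → ZMod n → Timed Bool

/-- What the process is about to do. -/
inductive Phase
  /-- test whether `A + 1` is further than `A`, and advance `A` if so -/
  | scan
  /-- output `ABC` if it is 3-stable, and output `(A + 1)BC` if it is 3-stable -/
  | report
  /-- stop if `(B, C) = (v_t, v_r)` -/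
  | check
  /-- decide whether `B` or `C` is killed -/
  | choose
  /-- kill `B`, that is, replace `B` by `B + 1` -/
  | killB
  /-- kill `C`, that is, replace `C` by `C + 1` -/
  | killC
  /-- the process has stopped -/
  | done

/-- A configuration: the phase, the three pointers and the triangles output so far. -/
structure Config (n : ℕ) where
  phase : Phase
  A : ZMod n
  B : ZMod n
  C : ZMod n
  out : List (ZMod n × ZMod n × ZMod n)

/-- The initial configuration: `(A, B, C) = (v_r, v_s, v_t)` and nothing has been output. -/
def init {n : ℕ} (r s t : ZMod n) : Config n := ⟨.scan, r, s, t, []⟩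

/-- One step of the process. Pointer moves, pointer comparisons and outputs are elementary
operations; a stopped process stays as it is. -/
def step {n : ℕ} (T : Tests n) (r t : ZMod n) (σ : Config n) : Timed (Config n) :=
  match σ.phase with
  | .scan => do
      let A' ← tick (σ.A + 1)
      if ← T.farther σ.B σ.C A' σ.A then
        return { σ with A := A' }
      else
        return { σ with phase := .report }
  | .report => do
      let A' ← tick (σ.A + 1)
      let x ← T.threeStable σ.A σ.B σ.C
      let out₁ ← if x then tick ((σ.A, σ.B, σ.C) :: σ.out) else pure σ.out
      let y ← T.threeStable A' σ.B σ.C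
      let out₂ ← if y then tick ((A', σ.B, σ.C) :: out₁) else pure out₁
      return { σ with phase := .check, out := out₂ }
  | .check => do
      let b ← tick (decide (σ.B = t))
      let c ← tick (decide (σ.C = r))
      if b && c then
        return { σ with phase := .done }
      else
        return { σ with phase := .choose }
  | .choose => do
      if ← T.beyondI σ.A σ.B σ.C then
        return { σ with phase := .killC }
      else
        return { σ with phase := .killB }
  | .killB => do
      let B' ← tick (σ.B + 1)
      return { σ with phase := .scan, B := B' }
  | .killC => do
      let C' ← tick (σ.C + 1)
      return { σ with phase := .scan, C := C' }
  | .done => pure σ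

/-- The configuration after `k` steps, with the total number of elementary operations. -/
def run {n : ℕ} (T : Tests n) (r s t : ZMod n) : ℕ → Timed (Config n)
  | 0 => pure (init r s t)
  | k + 1 => run T r s t k >>= step T r t

/-- The triangle with corners `i, j, k` occurs in the list `L`, possibly with its corners rotated. -/
def Listed {n : ℕ} (L : List (ZMod n × ZMod n × ZMod n)) (i j k : ZMod n) : Prop :=
  (i, j, k) ∈ L ∨ (j, k, i) ∈ L ∨ (k, i, j) ∈ L

/-! ## Real arithmetic as elementary operations -/

/-- Subtraction of two real numbers. -/
noncomputable def subR (x y : ℝ) : Timed ℝ := tick (x - y)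

/-- Multiplication of two real numbers. -/
noncomputable def mulR (x y : ℝ) : Timed ℝ := tick (x * y)

/-- Comparison of two real numbers. -/
noncomputable def ltR (x y : ℝ) : Timed Bool := tick (decide (x < y))

/-- The absolute value, computed by a comparison and a subtraction. -/
noncomputable def absR (x : ℝ) : Timed ℝ := do
  if ← ltR x 0 then subR 0 x else pure x

/-- The cross product of two vectors given by their coordinates. -/
noncomputable def crossR (u w : ℝ × ℝ) : Timed ℝ := do
  let x ← mulR u.1 w.2
  let y ← mulR u.2 w.1
  subR x y

namespace ConvexPolygon

variable {n : ℕ} (P : ConvexPolygon n)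

/-! ### The tests as they are written in the description of the process -/

open Classical in
/-- The tests, decided by their geometric meaning (each of them in one operation). -/
noncomputable def geometricTests : Tests n where
  farther B C X Y := tick (decide (P.Farther B C X Y))
  threeStable A B C := tick (decide (P.ThreeStable A B C))
  beyondI A B C := tick (decide (P.BeyondI A B C))

/-- The configuration of the process after `k` steps, started with `(v_r, v_s, v_t)`. -/
noncomputable def config (r s t : ZMod n) (k : ℕ) : Config n :=
  (run P.geometricTests r s t k).val

/-! ### The tests by real arithmetic on the coordinates of the vertices -/

/-- Read one coordinate of a vertex. -/
def readR (i : ZMod n) (a : Fin 2) : Timed ℝ := tick (P.vertex i a)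

/-- The vector from vertex `i` to vertex `j`. -/
noncomputable def vecR (i j : ZMod n) : Timed (ℝ × ℝ) := do
  let x ← subR (← P.readR j 0) (← P.readR i 0)
  let y ← subR (← P.readR j 1) (← P.readR i 1)
  return (x, y)

/-- Twice the area of the triangle `BCX`. -/
noncomputable def areaR (B C X : ZMod n) : Timed ℝ := do
  absR (← crossR (← P.vecR B C) (← P.vecR B X))

/-- Compare the distances of `X` and `Y` to the line `BC` by comparing two areas. -/
noncomputable def fartherR (B C X Y : ZMod n) : Timed Bool := do
  ltR (← P.areaR B C Y) (← P.areaR B C X)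

/-- Neither neighbour of `A` is further than `A` from the line `BC`. -/
noncomputable def cornerR (A B C : ZMod n) : Timed Bool := do
  let next ← tick (A + 1)
  let prev ← tick (A - 1)
  let x ← P.fartherR B C next A
  let y ← P.fartherR B C prev A
  return !x && !y

/-- The test for 3-stability: `A, B, C` are in clockwise order, and no corner can be improved by
moving it to a neighbouring vertex. -/
noncomputable def threeStableR (A B C : ZMod n) : Timed Bool := do
  if ← ltR (← crossR (← P.vecR B C) (← P.vecR B A)) 0 then
    let a ← P.cornerR A B C
    let b ← P.cornerR B C A
    let c ← P.cornerR C A B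
    return a && b && c
  else
    return false

/-- The test of `A` against the point `I` of the pair `(B, C)`. With `d` the vector from `B` to `C`,
`I` exists iff `0 < cross (edge C) (edge B)`, and then it is the point
`B + (cross d (edge B) / cross (edge C) (edge B)) • edge C`. -/
noncomputable def beyondIR (A B C : ZMod n) : Timed Bool := do
  let B' ← tick (B + 1)
  let C' ← tick (C + 1)
  let d ← P.vecR B C
  let eB ← P.vecR B B'
  let eC ← P.vecR C C'
  let D ← crossR eC eB
  if ← ltR 0 D then
    let hA ← P.areaR B C A
    let hC ← absR (← crossR d eC)
    ltR (← mulR hC (← crossR d eB)) (← mulR hA D)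
  else
    return false

/-- The tests, carried out by real arithmetic. -/
noncomputable def arithmeticTests : Tests n where
  farther := P.fartherR
  threeStable := P.threeStableR
  beyondI := P.beyondIR

end ConvexPolygon

end RotateAndKill

namespace RotateAndKill

/-! ## Distance to a line -/

/-! Vertices are lifted to integer indices, so that cyclic order becomes ordinary order within one
turn. Comparing distances to a line through two vertices becomes comparing signed areas, which are
affine in the apex. Along the boundary of a convex polygon an affine function rises once and falls
once. This fact, `IsAffine.valley`, drives most of the proof; it makes local maxima global, so
stability can be tested at two neighbours.

Two 3-stable triangles always interleave (`StableTriple.interleave`), so up to rotation every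
3-stable triangle has a pair of corners in the ranges swept by `B` and `C`. The point `I` decides
which pointer is expendable. If `b` forms a 3-stable triangle with a later `c'`, the apex lies
beyond `I` (`StableTriple.beyond`), hence so does the furthest vertex. If `c` forms one with a later
`b'`, no vertex lies beyond `I` (`StableTriple.not_beyond`); that direction needs an apex not past
`b`, which interleaving supplies. So each kill discards only dead pairs. As `(t, r)` is not dead,
neither pointer leaves its range before the end.

At a visited pair at most two vertices are furthest, and they are adjacent. As `A` stops at the
first of them, testing `A` and `A + 1` suffices. The one exception is the initial pair, where `A =
r` may be the second; the triangle `s, t, r - 1` missed there is found later through the pair `(t, r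
- 1)`. All this is carried by `Invariant`. It also contains a potential that grows by exactly one
per step, which gives termination and the linear bound. -/

lemma abs_cross_le (u w : Pt) : |cross u w| ≤ ‖u‖ * ‖w‖ := by
  refine abs_le_of_sq_le_sq ?_ (by positivity)
  have hu : ‖u‖ ^ 2 = u 0 ^ 2 + u 1 ^ 2 := by
    rw [EuclideanSpace.real_norm_sq_eq, Fin.sum_univ_two]
  have hw : ‖w‖ ^ 2 = w 0 ^ 2 + w 1 ^ 2 := by
    rw [EuclideanSpace.real_norm_sq_eq, Fin.sum_univ_two]
  rw [mul_pow, hu, hw, cross]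
  nlinarith [sq_nonneg (u 0 * w 0 + u 1 * w 1)]

lemma lineDist_eq {B C : Pt} (h : B ≠ C) (X : Pt) :
    lineDist B C X = |cross (C - B) (X - B)| / ‖C - B‖ := by
  have hd : 0 < ‖C - B‖ := norm_pos_iff.2 (sub_ne_zero.2 h.symm)
  have hd2 : ‖C - B‖ ^ 2 = (C 0 - B 0) ^ 2 + (C 1 - B 1) ^ 2 := by
    rw [EuclideanSpace.real_norm_sq_eq, Fin.sum_univ_two]; simp
  have hpos : 0 < (C 0 - B 0) ^ 2 + (C 1 - B 1) ^ 2 := by rw [← hd2]; positivity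
  refine le_antisymm ?_ ?_
  -- `q` is the parameter of the foot of the perpendicular from `X`.
  · set q : ℝ := ((C 0 - B 0) * (X 0 - B 0) + (C 1 - B 1) * (X 1 - B 1)) / ‖C - B‖ ^ 2 with hq
    have hmem : AffineMap.lineMap B C q ∈ (line[ℝ, B, C] : Set Pt) :=
      AffineMap.lineMap_mem_affineSpan_pair q B C
    refine (Metric.infDist_le_dist_of_mem hmem).trans (le_of_eq ?_)
    rw [eq_div_iff hd.ne', dist_eq_norm]
    have h0 : 0 ≤ ‖X - AffineMap.lineMap B C q‖ * ‖C - B‖ := by positivity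
    rw [← abs_of_nonneg h0, ← sq_eq_sq_iff_abs_eq_abs, mul_pow, hd2,
      EuclideanSpace.real_norm_sq_eq, Fin.sum_univ_two]
    have hq' : q * ((C 0 - B 0) ^ 2 + (C 1 - B 1) ^ 2) =
        (C 0 - B 0) * (X 0 - B 0) + (C 1 - B 1) * (X 1 - B 1) := by
      rw [hq, hd2, div_mul_cancel₀ _ hpos.ne']
    have e : ∀ i, (X - AffineMap.lineMap B C q : Pt) i = X i - B i - q * (C i - B i) := by
      intro i
      simp [AffineMap.lineMap_apply]
      ring
    rw [e, e, cross]
    simp only [PiLp.sub_apply]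
    linear_combination (q * ((C 0 - B 0) ^ 2 + (C 1 - B 1) ^ 2) -
      ((C 0 - B 0) * (X 0 - B 0) + (C 1 - B 1) * (X 1 - B 1))) * hq'
  · refine (Metric.le_infDist ⟨B, left_mem_affineSpan_pair ℝ B C⟩).2 fun Y hY => ?_
    obtain ⟨q, rfl⟩ := mem_affineSpan_pair_iff_exists_lineMap_eq.1 hY
    rw [div_le_iff₀ hd, dist_eq_norm, mul_comm]
    refine le_trans (le_of_eq ?_) (abs_cross_le (C - B) (X - AffineMap.lineMap B C q))
    congr 1
    simp [cross, AffineMap.lineMap_apply]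
    ring

namespace ConvexPolygon

variable {n : ℕ} (P : ConvexPolygon n)

/-! ## Integer indices -/

/-- The vertex with an integer index. -/
def lift (i : ℤ) : Pt := P.vertex (i : ZMod n)

/-- Twice the signed area of the triangle with corners `b, c, x`, positive iff they are in
clockwise order. -/
noncomputable def area (b c x : ℤ) : ℝ := cross (P.lift x - P.lift b) (P.lift c - P.lift b)

lemma area_eq (b c x : ℤ) : P.area b c x =
    (P.lift x 0 - P.lift b 0) * (P.lift c 1 - P.lift b 1) -
      (P.lift x 1 - P.lift b 1) * (P.lift c 0 - P.lift b 0) := by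
  simp [area, cross]

lemma neg_cross_eq_area (b c x : ℤ) :
    cross (P.lift c - P.lift b) (P.lift x - P.lift b) = -P.area b c x := by
  rw [area, cross, cross]; ring

include P in
lemma neZero : NeZero n := ⟨by have := P.three_le; omega⟩

@[simp] lemma lift_add (i : ℤ) : P.lift (i + n) = P.lift i := by simp [lift]

@[simp] lemma lift_sub (i : ℤ) : P.lift (i - n) = P.lift i := by simp [lift]

include P in
lemma val_sub {i j : ℤ} (h : i ≤ j) (h' : j < i + n) :
    ((((j : ZMod n) - (i : ZMod n)).val : ℕ) : ℤ) = j - i := by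
  have := P.neZero
  rw [← Int.cast_sub, ZMod.val_intCast]
  exact Int.emod_eq_of_lt (by omega) (by omega)

include P in
lemma exists_lift (i : ZMod n) (p : ℤ) : ∃ x : ℤ, p ≤ x ∧ x < p + n ∧ (x : ZMod n) = i := by
  have := P.neZero
  refine ⟨p + (i - (p : ZMod n)).val, by omega, ?_, ?_⟩
  · have := ZMod.val_lt (i - (p : ZMod n)); omega
  · simp

include P in
lemma cast_inj {i j : ℤ} (h : (i : ZMod n) = j) (h1 : i < j + n) (h2 : j < i + n) : i = j := by
  have h3 := (ZMod.intCast_eq_intCast_iff_dvd_sub i j n).1 h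
  obtain ⟨k, hk⟩ := h3
  have hn : (0 : ℤ) < n := by have := P.three_le; omega
  have : k < 1 := by by_contra hc; nlinarith
  have : -1 < k := by by_contra hc; nlinarith
  have : k = 0 := by omega
  subst this; omega

lemma area_pos {i j k : ℤ} (h1 : i < j) (h2 : j < k) (h3 : k < i + n) : 0 < P.area i j k := by
  have hj := P.val_sub (i := i) (j := j) (by omega) (by omega)
  have hk := P.val_sub (i := i) (j := k) (by omega) (by omega)
  have := P.clockwise i j k (by omega) (by omega)
  have h := P.neg_cross_eq_area i j k
  rw [lift, lift, lift] at h
  linarith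

lemma area_rotate (i j k : ℤ) : P.area i j k = P.area j k i := by
  rw [area_eq, area_eq]; ring

lemma area_swap (i j k : ℤ) : P.area j i k = -P.area i j k := by
  rw [area_eq, area_eq]; ring

lemma area_swap_right (i j k : ℤ) : P.area i k j = -P.area i j k := by
  rw [area_eq, area_eq]; ring

@[simp] lemma area_left (b c : ℤ) : P.area b c b = 0 := by rw [area_eq]; ring

@[simp] lemma area_right (b c : ℤ) : P.area b c c = 0 := by rw [area_eq]; ring

@[simp] lemma area_left_add (b c x : ℤ) : P.area (b + n) c x = P.area b c x := by simp [area]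

@[simp] lemma area_right_add (b c x : ℤ) : P.area b (c + n) x = P.area b c x := by simp [area]

@[simp] lemma area_apex_add (b c x : ℤ) : P.area b c (x + n) = P.area b c x := by simp [area]

@[simp] lemma area_apex_sub (b c x : ℤ) : P.area b c (x - n) = P.area b c x := by simp [area]

lemma area_nonneg {b c x : ℤ} (h : b < c) (h1 : c ≤ x) (h2 : x ≤ b + n) : 0 ≤ P.area b c x := by
  rcases h1.eq_or_lt with rfl | h1
  · simp
  rcases h2.eq_or_lt with rfl | h2
  · simp
  exact (P.area_pos h h1 h2).le

lemma area_nonpos {b c x : ℤ} (h : c < b + n) (h1 : b ≤ x) (h2 : x ≤ c) : P.area b c x ≤ 0 := by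
  rcases h1.eq_or_lt with rfl | h1
  · simp
  rcases h2.eq_or_lt with rfl | h2
  · simp
  have := P.area_pos h1 h2 h
  rw [area_swap_right]
  linarith

lemma exists_lift_eq (x p : ℤ) : ∃ y : ℤ, p ≤ y ∧ y < p + n ∧ P.lift y = P.lift x := by
  obtain ⟨y, h1, h2, h3⟩ := P.exists_lift (x : ZMod n) p
  exact ⟨y, h1, h2, by rw [lift, lift, h3]⟩

lemma edge_area_nonneg (b x : ℤ) : 0 ≤ P.area b (b + 1) x := by
  obtain ⟨y, h1, h2, h3⟩ := P.exists_lift_eq x b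
  have : P.area b (b + 1) x = P.area b (b + 1) y := by rw [area, area, h3]
  rw [this]
  rcases h1.eq_or_lt with rfl | h1
  · simp
  exact P.area_nonneg (by omega) (by omega) (by omega)

/-! ## Affine functions along the boundary -/

/-- The restriction of an affine function on the plane to the vertices. -/
def IsAffine (f : ℤ → ℝ) : Prop :=
  ∃ α β γ : ℝ, ∀ x, f x = α * P.lift x 0 + β * P.lift x 1 + γ

lemma isAffine_area (b c : ℤ) : P.IsAffine (P.area b c) :=
  ⟨P.lift c 1 - P.lift b 1, -(P.lift c 0 - P.lift b 0),
    -P.lift b 0 * (P.lift c 1 - P.lift b 1) + P.lift b 1 * (P.lift c 0 - P.lift b 0),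
    fun x => by rw [area_eq]; ring⟩

variable {P}

lemma IsAffine.apply_add {f : ℤ → ℝ} (hf : P.IsAffine f) (x : ℤ) : f (x + n) = f x := by
  obtain ⟨α, β, γ, h⟩ := hf
  rw [h, h, lift_add]

lemma IsAffine.neg {f : ℤ → ℝ} (hf : P.IsAffine f) : P.IsAffine fun x => -f x := by
  obtain ⟨α, β, γ, h⟩ := hf
  exact ⟨-α, -β, -γ, fun x => by simp only [h]; ring⟩

/-- A vertex at which `f` is no larger than at a vertex before and at a vertex after it minimizes
`f` over the rest of the boundary. -/
lemma IsAffine.valley {f : ℤ → ℝ} (hf : P.IsAffine f) {x p q b : ℤ} (h1 : x < p) (h2 : p < q)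
    (h3 : q < b) (h4 : b < x + n) (hx : f p ≤ f x) (hq : f p ≤ f q) : f p ≤ f b := by
  have e1 := P.area_pos h2 (show q < x + n by omega) (by omega)
  have e2 := P.area_pos (show p < b by omega) h4 (by omega)
  have e3 := P.area_pos h2 h3 (by omega)
  rw [area_apex_add] at e1 e2
  have key : (f b - f p) * P.area p q x =
      (f q - f p) * P.area p b x + (f x - f p) * P.area p q b := by
    obtain ⟨α, β, γ, h⟩ := hf
    simp only [h, area_eq]
    ring
  have : 0 ≤ (f b - f p) * P.area p q x := by
    rw [key]
    exact add_nonneg (mul_nonneg (sub_nonneg.2 hq) e2.le) (mul_nonneg (sub_nonneg.2 hx) e3.le)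
  have := nonneg_of_mul_nonneg_left this e1
  linarith

/-- Unimodality again: a vertex higher than a local maximum would contradict `IsAffine.valley` for
`-f`. -/
lemma IsAffine.le_of_neighbors {f : ℤ → ℝ} (hf : P.IsAffine f) {p : ℤ} (h1 : f (p - 1) ≤ f p)
    (h2 : f (p + 1) ≤ f p) (x : ℤ) : f x ≤ f p := by
  obtain ⟨y, hy1, hy2, hy3⟩ := P.exists_lift_eq x (p - 1)
  have : f x = f y := by
    obtain ⟨α, β, γ, h⟩ := hf
    rw [h, h, hy3]
  rw [this]
  rcases hy1.eq_or_lt with rfl | hy1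
  · exact h1
  by_cases e : y = p
  · rw [e]
  by_cases e' : y = p + 1
  · rwa [e']
  have := hf.neg.valley (x := p - 1) (p := p) (q := p + 1) (b := y) (by omega) (by omega)
    (by omega) (by omega) (by linarith) (by linarith)
  linarith

variable (P)

/-! ## Stability in terms of areas -/

lemma lift_ne {b c : ℤ} (h1 : b < c) (h2 : c < b + n) : P.lift b ≠ P.lift c := by
  intro h
  have hn := P.three_le
  by_cases e : c = b + 1
  · have := P.area_pos h1 (show c < c + 1 by omega) (by omega)
    simp [area, h, cross] at this
  · have := P.area_pos (show b < b + 1 by omega) (show b + 1 < c by omega) h2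
    simp [area, h, cross] at this

lemma lineDist_lift {b c : ℤ} (h1 : b < c) (h2 : c < b + n) (x : ℤ) :
    lineDist (P.lift b) (P.lift c) (P.lift x) = |P.area b c x| / ‖P.lift c - P.lift b‖ := by
  rw [lineDist_eq (P.lift_ne h1 h2), neg_cross_eq_area, abs_neg]

lemma norm_sub_pos {b c : ℤ} (h1 : b < c) (h2 : c < b + n) : 0 < ‖P.lift c - P.lift b‖ :=
  norm_pos_iff.2 (sub_ne_zero.2 (P.lift_ne h1 h2).symm)

lemma farther_iff {b c : ℤ} (h1 : b < c) (h2 : c < b + n) (x y : ℤ) :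
    P.Farther b c x y ↔ |P.area b c y| < |P.area b c x| := by
  change lineDist (P.lift b) (P.lift c) (P.lift y) < lineDist (P.lift b) (P.lift c) (P.lift x) ↔ _
  rw [P.lineDist_lift h1 h2, P.lineDist_lift h1 h2, div_lt_div_iff_of_pos_right (P.norm_sub_pos h1 h2)]

/-- Vertices not on the right of `bc` have nonpositive area, so the restriction to the right side
can be dropped. The other points of the polygon follow because a half-plane containing the vertices
contains their hull. -/
lemma stable_iff {b c a : ℤ} (h1 : b < c) (h2 : c < a) (h3 : a < b + n) :
    P.Stable (P.lift a) (P.lift b) (P.lift c) ↔ ∀ x, P.area b c x ≤ P.area b c a := by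
  have hc : c < b + n := by omega
  have hd := P.norm_sub_pos h1 hc
  have ha := P.area_pos h1 h2 h3
  constructor
  · rintro ⟨-, h⟩ x
    rcases le_or_gt (P.area b c x) 0 with hx | hx
    · linarith
    have := h (P.lift x) (subset_convexHull ℝ _ ⟨_, rfl⟩) (by
      change cross _ _ < 0
      rw [neg_cross_eq_area]; linarith)
    rwa [P.lineDist_lift h1 hc, P.lineDist_lift h1 hc, div_le_div_iff_of_pos_right hd,
      abs_of_pos hx, abs_of_pos ha] at this
  · intro h
    refine ⟨by change cross _ _ < 0; rw [neg_cross_eq_area]; linarith, fun X hX hr => ?_⟩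
    have hconv : Convex ℝ
        {X : Pt | -P.area b c a ≤ cross (P.lift c - P.lift b) (X - P.lift b)} := by
      intro X hX Y hY α β hα hβ hαβ
      simp only [Set.mem_ofPred_eq] at *
      have : cross (P.lift c - P.lift b) (α • X + β • Y - P.lift b) =
          α * cross (P.lift c - P.lift b) (X - P.lift b) +
          β * cross (P.lift c - P.lift b) (Y - P.lift b) := by
        obtain rfl : β = 1 - α := by linarith
        simp [cross]
        ring
      rw [this]
      have e1 := mul_le_mul_of_nonneg_left hX hα
      have e2 := mul_le_mul_of_nonneg_left hY hβ
      have : α * -P.area b c a + β * -P.area b c a = -P.area b c a := by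
        rw [← add_mul, hαβ, one_mul]
      linarith
    have hX' := convexHull_min (s := Set.range P.vertex) (by
      rintro _ ⟨i, rfl⟩
      obtain ⟨x, -, -, rfl⟩ := P.exists_lift i 0
      change -P.area b c a ≤ cross (P.lift c - P.lift b) (P.lift x - P.lift b)
      rw [neg_cross_eq_area]
      linarith [h x]) hconv hX
    rw [P.lineDist_lift h1 hc, lineDist_eq (P.lift_ne h1 hc), div_le_div_iff_of_pos_right hd,
      abs_of_pos ha, abs_of_neg hr]
    simp only [Set.mem_ofPred_eq] at hX'
    linarith

/-- The vertices `i < j < k < i + n` form a 3-stable triangle. -/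
structure StableTriple (i j k : ℤ) : Prop where
  lt₁ : i < j
  lt₂ : j < k
  lt₃ : k < i + n
  max₁ : ∀ x, P.area j k x ≤ P.area j k i
  max₂ : ∀ x, P.area k i x ≤ P.area k i j
  max₃ : ∀ x, P.area i j x ≤ P.area i j k

variable {P}

lemma StableTriple.rotate {i j k : ℤ} (h : P.StableTriple i j k) : P.StableTriple j k (i + n) where
  lt₁ := h.lt₂
  lt₂ := h.lt₃
  lt₃ := by have := h.lt₁; omega
  max₁ := by simpa using h.max₂
  max₂ := by simpa using h.max₃
  max₃ := by simpa using h.max₁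

variable (P)

lemma threeStable_iff {i j k : ℤ} (h1 : i < j) (h2 : j < k) (h3 : k < i + n) :
    P.ThreeStable i j k ↔ P.StableTriple i j k := by
  have e1 := P.stable_iff h1 h2 h3
  have e2 := P.stable_iff h2 h3 (show i + n < j + n by omega)
  have e3 := P.stable_iff h3 (show i + n < j + n by omega) (by omega)
  simp only [lift_add, area_apex_add, area_right_add] at e2 e3
  change (P.Stable (P.lift i) (P.lift j) (P.lift k) ∧ P.Stable (P.lift j) (P.lift k) (P.lift i) ∧
    P.Stable (P.lift k) (P.lift i) (P.lift j)) ↔ _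
  rw [e1, e2, e3]
  exact ⟨fun ⟨a, b, c⟩ => ⟨h1, h2, h3, a, b, c⟩, fun h => ⟨h.max₁, h.max₂, h.max₃⟩⟩

variable {P}

lemma StableTriple.threeStable {i j k : ℤ} (h : P.StableTriple i j k) : P.ThreeStable i j k :=
  (P.threeStable_iff h.lt₁ h.lt₂ h.lt₃).2 h

lemma ThreeStable.rotate {i j k : ZMod n} (h : P.ThreeStable i j k) : P.ThreeStable j k i :=
  ⟨h.2.1, h.2.2, h.1⟩

variable (P)

/-- A vertex on the right of `v_b v_c` comes after `c` and before `b`. -/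
lemma lt_of_area_pos {b c x : ℤ} (hc : c < b + n) (h1 : b ≤ x)
    (h : 0 < P.area b c x) : c < x := by
  by_contra hx
  have := P.area_nonpos hc h1 (by omega)
  linarith

variable {P}

lemma ThreeStable.exists_lift {i j k : ZMod n} (h : P.ThreeStable i j k) {j' : ℤ}
    (hj : (j' : ZMod n) = j) :
    ∃ k' i' : ℤ, (k' : ZMod n) = k ∧ (i' : ZMod n) = i ∧ P.StableTriple j' k' i' := by
  obtain ⟨k', hk1, hk2, hk⟩ := P.exists_lift k j'
  obtain ⟨i', hi1, hi2, hi⟩ := P.exists_lift i j'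
  subst hj hk hi
  have h0 : cross (P.lift k' - P.lift j') (P.lift i' - P.lift j') < 0 := h.1.1
  rw [neg_cross_eq_area] at h0
  have hki := P.lt_of_area_pos hk2 hi1 (by linarith)
  have hjk : j' < k' := by
    rcases hk1.eq_or_lt with e | e
    · rw [← e] at h0; simp [area, cross] at h0
    · exact e
  exact ⟨k', i', rfl, rfl, (P.threeStable_iff hjk hki hi2).1 h.rotate⟩

/-! ## Interleaving of 3-stable triangles -/

variable (P) in
-- Both sides are the cross product of `x - y` with `j - i`, up to a common sign. This trades a
-- comparison of `x` and `y` over the line `ij` for one of `i` and `j` over the line `xy`, so that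
-- stability conditions of different triangles become statements about one affine function.
lemma area_sub_area (i j x y : ℤ) :
    P.area i j x - P.area i j y = P.area y x i - P.area y x j := by
  simp only [area_eq]; ring

/-- If two corners of a 3-stable triangle lie in the half-open arc `[x, y)` cut off by the corners
`x, y` of another one, and the third does not, then the first corner is `x` and the third one does
not come after the third corner `z` of the other triangle. -/
lemma StableTriple.eq_and_le_of_two_mem {x y z p q r : ℤ} (T : P.StableTriple x y z)
    (T' : P.StableTriple p q r) (h1 : x ≤ p) (h2 : q < y) (h3 : y ≤ r) (h4 : r ≤ x + n) :
    p = x ∧ r ≤ z := by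
  obtain ⟨t1, t2, t3⟩ := And.intro T.lt₁ (And.intro T.lt₂ T.lt₃)
  obtain ⟨u1, u2, u3⟩ := And.intro T'.lt₁ (And.intro T'.lt₂ T'.lt₃)
  have aH := P.isAffine_area q y
  have aG := P.isAffine_area x p
  -- Stability of `q` and of `y`, both read as conditions on the height over `qy`.
  have H1 : P.area q y r ≤ P.area q y p := by
    have := T'.max₂ y; have := P.area_sub_area r p y q; linarith
  have H2 : P.area q y x ≤ P.area q y z := by
    have := T.max₂ q; have := P.area_sub_area z x y q; linarith
  -- If `r` came after `z`, it would be a valley between `z` and `x + n`, so its height would be at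
  -- most that of `q`, which is zero; but `r` lies strictly to the right of `qy`.
  have after : z < r → (p = x ∨ P.area q y p < P.area q y x) → False := fun hz hp => by
    have hp' : P.area q y p ≤ P.area q y x := by
      rcases hp with rfl | hp
      · rfl
      · exact hp.le
    rcases h4.eq_or_lt with e | e
    · rcases hp with hp | hp
      · omega
      · rw [e, area_apex_add] at H1
        linarith
    have := aH.valley (x := z) (p := r) (q := x + n) (b := q + n) hz e (by omega) (by omega)
      (by linarith) (by rw [aH.apply_add]; linarith)
    rw [aH.apply_add, area_left] at this
    have := P.area_pos h2 (show y < r by omega) (by omega)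
    linarith
  rcases h1.eq_or_lt with rfl | hxp
  · exact ⟨rfl, not_lt.1 fun hz => after hz (.inl rfl)⟩
  exfalso
  have H3 : P.area q y p < P.area q y x := by
    by_contra! h
    have := aH.valley (x := z - n) (p := x) (q := p) (b := q) (by omega) hxp u1 (by omega)
      (by simpa using H2) h
    rw [area_left] at this
    have := P.area_pos h2 (show y < x + n by omega) (by omega)
    rw [area_apex_add] at this
    linarith
  rcases lt_trichotomy r z with hz | rfl | hz
  -- Here the height over `xp` is used instead, with the stability conditions of `p` and `x`. It
  -- makes `r` a valley between `y` and `z`, or contradicts `r = y` at once.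
  · have G1 : P.area x p r ≤ P.area x p q := by
      have := T'.max₁ x; have := P.area_sub_area q r p x; linarith
    have G2 : P.area x p y ≤ P.area x p z := by
      have := T.max₁ p; have := P.area_sub_area y z x p
      rw [P.area_swap x p, P.area_swap x p] at this; linarith
    have G3 : P.area x p q < P.area x p y := by
      by_contra! h
      have := aG.valley (x := q) (p := y) (q := z) (b := x + n) h2 t2 t3 (by omega) h G2
      rw [aG.apply_add, area_left] at this
      have := P.area_pos hxp (show p < y by omega) (by omega)
      linarith
    rcases h3.eq_or_lt with rfl | h3
    · linarith
    have := aG.valley (x := y) (p := r) (q := z) (b := x + n) h3 hz t3 (by omega) (by linarith)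
      (by linarith)
    rw [aG.apply_add, area_left] at this
    have := P.area_pos hxp (show p < r by omega) (by omega)
    linarith
  · linarith
  · exact after hz (.inr H3)

/-- The corners of a 3-stable triangle do not all lie in the half-open arc `[x, y)` cut off by two
corners of another one. -/
lemma StableTriple.false_of_three_mem {x y z p q r : ℤ} (T : P.StableTriple x y z)
    (T' : P.StableTriple p q r) (h1 : x ≤ p) (h2 : r < y) : False := by
  obtain ⟨t1, t2, t3⟩ := And.intro T.lt₁ (And.intro T.lt₂ T.lt₃)
  obtain ⟨u1, u2, u3⟩ := And.intro T'.lt₁ (And.intro T'.lt₂ T'.lt₃)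
  have aH := P.isAffine_area r y
  have H1 : P.area r y p ≤ P.area r y q := by
    have := T'.max₃ y; have := P.area_sub_area p q y r; linarith
  have H2 : P.area r y x ≤ P.area r y z := by
    have := T.max₂ r; have := P.area_sub_area z x y r; linarith
  have hx : 0 < P.area r y x := by
    have := P.area_pos h2 (show y < x + n by omega) (by omega)
    rwa [area_apex_add] at this
  -- Otherwise `x` is a valley between `z - n` and `v`, which forces its positive height down to
  -- that of `r`, namely zero.
  have key : ∀ v, x < v → v < r → P.area r y x ≤ P.area r y v → False := fun v hv hv' h => by
    have := aH.valley (x := z - n) (p := x) (q := v) (b := r) (by omega) hv hv' (by omega)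
      (by simpa using H2) h
    rw [area_left] at this
    linarith
  rcases h1.eq_or_lt with rfl | hxp
  · exact key q u1 u2 H1
  rcases le_total (P.area r y x) (P.area r y p) with h | h
  · exact key p hxp (by omega) h
  have := aH.valley (x := x) (p := p) (q := q) (b := r) hxp u1 u2 (by omega) h H1
  rw [area_left] at this
  have h' := P.area_pos h2 (show y < p + n by omega) (by omega)
  rw [area_apex_add] at h'
  linarith

lemma StableTriple.sub {i j k : ℤ} (h : P.StableTriple i j k) :
    P.StableTriple (i - n) (j - n) (k - n) := by
  have e : ∀ b c : ℤ, P.area (b - n) (c - n) = P.area b c := fun b c => by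
    funext x; simp [area]
  exact ⟨by linarith [h.lt₁], by linarith [h.lt₂], by linarith [h.lt₃],
    by simpa [e] using h.max₁, by simpa [e] using h.max₂, by simpa [e] using h.max₃⟩

lemma StableTriple.rotate' {i j k : ℤ} (h : P.StableTriple i j k) :
    P.StableTriple (k - n) i j := by
  simpa using h.rotate.rotate.sub

/-- Every 3-stable triangle interleaves with a given one. -/
lemma StableTriple.interleave {s t r : ℤ} (T : P.StableTriple s t r) {i j k : ZMod n}
    (h : P.ThreeStable i j k) :
    ∃ j' k' i' : ℤ, P.StableTriple j' k' i' ∧ s ≤ j' ∧ j' ≤ t ∧ t ≤ k' ∧ k' ≤ r ∧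
      (((i' : ZMod n), (j' : ZMod n), (k' : ZMod n)) = (i, j, k) ∨
        ((i' : ZMod n), (j' : ZMod n), (k' : ZMod n)) = (j, k, i) ∨
        ((i' : ZMod n), (j' : ZMod n), (k' : ZMod n)) = (k, i, j)) := by
  obtain ⟨t1, t2, t3⟩ := And.intro T.lt₁ (And.intro T.lt₂ T.lt₃)
  -- The corners are rotated so that all three lie in the turn `[s, s + n)`. The cases below sort
  -- them into the arcs `[s, t)`, `[t, r)`, `[r, s + n)`.
  have norm : ∃ a b c : ℤ, P.StableTriple a b c ∧ s ≤ a ∧ c < s + n ∧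
      (((a : ZMod n), (b : ZMod n), (c : ZMod n)) = (i, j, k) ∨
        ((a : ZMod n), (b : ZMod n), (c : ZMod n)) = (j, k, i) ∨
        ((a : ZMod n), (b : ZMod n), (c : ZMod n)) = (k, i, j)) := by
    obtain ⟨j', hj1, hj2, hj⟩ := P.exists_lift j s
    obtain ⟨k', i', rfl, rfl, T'⟩ := h.exists_lift hj
    have := T'.lt₁; have := T'.lt₂; have := T'.lt₃
    by_cases h1 : i' < s + n
    · exact ⟨_, _, _, T', hj1, h1, by simp [hj]⟩
    by_cases h2 : k' < s + n
    · exact ⟨_, _, _, T'.rotate', by omega, h2, by simp [hj]⟩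
    · exact ⟨_, _, _, T'.rotate'.rotate', by omega, hj2, by simp [hj]⟩
  obtain ⟨a, b, c, T', ha, hc, hl⟩ := norm
  have h1 := T'.lt₁; have h2 := T'.lt₂
  have hl1 : ((c : ZMod n), (a : ZMod n), (b : ZMod n)) = (i, j, k) ∨
      ((c : ZMod n), (a : ZMod n), (b : ZMod n)) = (j, k, i) ∨
      ((c : ZMod n), (a : ZMod n), (b : ZMod n)) = (k, i, j) := by
    simp only [Prod.mk.injEq] at hl ⊢; tauto
  have hl2 : (((a + n : ℤ) : ZMod n), (b : ZMod n), (c : ZMod n)) = (i, j, k) ∨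
      (((a + n : ℤ) : ZMod n), (b : ZMod n), (c : ZMod n)) = (j, k, i) ∨
      (((a + n : ℤ) : ZMod n), (b : ZMod n), (c : ZMod n)) = (k, i, j) := by
    simpa using hl
  rcases lt_or_ge b t with hb | hb
  · rcases lt_or_ge c t with hc' | hc'
    · exact (T.false_of_three_mem T' ha hc').elim
    · have := T.eq_and_le_of_two_mem T' ha hb hc' hc.le
      exact ⟨b, c, a + n, T'.rotate, by omega, hb.le, hc', this.2, hl2⟩
  rcases lt_or_ge b r with hb' | hb'
  · rcases le_or_gt a t with ha' | ha'
    · exact ⟨a, b, c, T', ha, ha', hb, hb'.le, hl1⟩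
    · rcases lt_or_ge c r with hc' | hc'
      · exact (T.rotate.false_of_three_mem T' ha'.le hc').elim
      · have := T.rotate.eq_and_le_of_two_mem T' ha'.le hb' hc' (by omega)
        omega
  · rcases lt_or_ge a r with ha' | ha'
    · have := T.rotate.rotate.eq_and_le_of_two_mem T'.rotate hb' hc (by omega) (by omega)
      exact ⟨a, b, c, T', ha, by omega, hb, this.1.le, hl1⟩
    · exact (T.rotate.rotate.false_of_three_mem T' ha' hc).elim

/-- A pair in the ranges of the pointers that is not dead has its apex between `r` and `s`. -/
lemma StableTriple.exists_apex {s t r j k i : ℤ} (T : P.StableTriple s t r)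
    (T' : P.StableTriple j k i) (h2 : j ≤ t) (h3 : t ≤ k) (h4 : k ≤ r) :
    ∃ i', i' ≤ s + n ∧ P.StableTriple j k i' := by
  obtain ⟨t1, t2, t3⟩ := And.intro T.lt₁ (And.intro T.lt₂ T.lt₃)
  obtain ⟨u1, u2, u3⟩ := And.intro T'.lt₁ (And.intro T'.lt₂ T'.lt₃)
  by_cases hi : i ≤ s + n
  · exact ⟨i, hi, T'⟩
  -- An apex past `s + n` would put two corners into one arc, against `eq_and_le_of_two_mem`. Only
  -- the pair `(t, r)` escapes this argument, and there the given triangle supplies an apex.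
  rcases h2.eq_or_lt with rfl | h2
  · rcases h4.eq_or_lt with rfl | h4
    · exact ⟨s + n, le_rfl, T.rotate⟩
    · have := T.rotate.eq_and_le_of_two_mem T' le_rfl h4 (by omega) u3.le
      omega
  · have := T.eq_and_le_of_two_mem T'.rotate' (by omega) h2 h3 (by omega)
    omega

/-! ## The point `I` -/

variable (P) in
lemma edge_lift (i : ℤ) : P.edge i = P.lift (i + 1) - P.lift i := by simp [edge, lift]

variable (P) in
/-- The cross product of the edges `c` and `b`. -/
noncomputable def turn (b c : ℤ) : ℝ := P.area b (b + 1) (c + 1) - P.area b (b + 1) c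

variable (P) in
-- By Cramer's rule `I` is `b` plus `m` times the edge `c`, with `m = area b (b+1) c / turn b c`.
-- Its height over `bc`, measured as an area, is `m * area b c (c+1)`; clearing the denominator
-- gives the inequality.
lemma beyondI_iff {b c : ℤ} (h1 : b < c) (h2 : c < b + n) (a : ℤ) :
    P.BeyondI a b c ↔ 0 < P.turn b c ∧
      P.area b c (c + 1) * P.area b (b + 1) c < |P.area b c a| * P.turn b c := by
  have hn := P.three_le
  have hd := P.norm_sub_pos h1 h2
  have g0 := P.edge_area_nonneg b c
  have f0 := P.area_nonneg h1 (show c ≤ c + 1 by omega) (by omega)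
  have dist : ∀ m : ℝ, 0 ≤ m → lineDist (P.lift b) (P.lift c)
      (P.lift b + m • (P.lift (c + 1) - P.lift c)) =
      m * P.area b c (c + 1) / ‖P.lift c - P.lift b‖ := fun m hm => by
    rw [lineDist_eq (P.lift_ne h1 h2)]
    have : cross (P.lift c - P.lift b)
        (P.lift b + m • (P.lift (c + 1) - P.lift c) - P.lift b) = -(m * P.area b c (c + 1)) := by
      simp [cross, area]; ring
    rw [this, abs_neg, abs_of_nonneg (mul_nonneg hm f0)]
  have unfold_def : P.BeyondI a b c ↔ ∃ I ∈ ray (P.lift b) (P.lift (c + 1) - P.lift c) ∩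
      ray (P.lift c) (-(P.lift (b + 1) - P.lift b)),
      lineDist (P.lift b) (P.lift c) I < lineDist (P.lift b) (P.lift c) (P.lift a) := by
    rw [BeyondI, pointI, edge_lift, edge_lift]; rfl
  rw [unfold_def, P.lineDist_lift h1 h2]
  constructor
  · rintro ⟨I, ⟨⟨m, hm, rfl⟩, l, hl, e⟩, hI⟩
    rw [dist m hm, div_lt_div_iff_of_pos_right hd] at hI
    have e0 := congrArg (fun X : Pt => X 0) e
    have e1 := congrArg (fun X : Pt => X 1) e
    simp only [PiLp.add_apply, PiLp.smul_apply, PiLp.sub_apply, PiLp.neg_apply, smul_eq_mul] at e0 e1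
    have k1 : P.area b (b + 1) c = m * P.turn b c := by
      simp only [area_eq, turn]
      linear_combination (P.lift (b + 1) 0 - P.lift b 0) * e1 -
        (P.lift (b + 1) 1 - P.lift b 1) * e0
    have k2 : P.area b c (c + 1) = l * P.turn b c := by
      simp only [area_eq, turn]
      linear_combination (P.lift (c + 1) 1 - P.lift c 1) * e0 -
        (P.lift (c + 1) 0 - P.lift c 0) * e1
    -- If `turn b c ≤ 0`, rays that meet would force both areas to vanish, which cannot happen at
    -- once for a polygon with at least three vertices.
    have hD : 0 < P.turn b c := by
      by_contra! hD
      have z1 : P.area b (b + 1) c = 0 :=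
        le_antisymm (k1 ▸ mul_nonpos_of_nonneg_of_nonpos hm hD) g0
      have z2 : P.area b c (c + 1) = 0 :=
        le_antisymm (k2 ▸ mul_nonpos_of_nonneg_of_nonpos hl hD) f0
      by_cases hc : c = b + 1
      · have := P.area_pos h1 (show c < c + 1 by omega) (by omega)
        linarith
      · have := P.area_pos (show b < b + 1 by omega) (show b + 1 < c by omega) h2
        linarith
    refine ⟨hD, ?_⟩
    rw [k1, ← mul_assoc]
    exact mul_lt_mul_of_pos_right (by linarith) hD
  · rintro ⟨hD, h⟩
    have hm : 0 ≤ P.area b (b + 1) c / P.turn b c := div_nonneg g0 hD.le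
    refine ⟨_, ⟨⟨_, hm, rfl⟩, P.area b c (c + 1) / P.turn b c, div_nonneg f0 hD.le, ?_⟩, ?_⟩
    · have hD' := hD.ne'
      ext i
      simp only [PiLp.add_apply, PiLp.smul_apply, PiLp.sub_apply, PiLp.neg_apply, smul_eq_mul]
      field_simp
      fin_cases i <;> simp [area_eq, turn] <;> ring
    · rw [dist _ hm, div_lt_div_iff_of_pos_right hd, div_mul_eq_mul_div, div_lt_iff₀ hD]
      linarith

/-- If `b, c', a` is 3-stable with `c'` after `c`, then `a` is further than the point `I` of
`(b, c)` from the line `bc`. -/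
lemma StableTriple.beyond {b c c' a : ℤ} (T : P.StableTriple b c' a) (h1 : b < c) (h2 : c < c') :
    0 < P.turn b c ∧ P.area b c (c + 1) * P.area b (b + 1) c < P.area b c a * P.turn b c := by
  obtain ⟨-, u2, u3⟩ := And.intro T.lt₁ (And.intro T.lt₂ T.lt₃)
  have aF := P.isAffine_area b (b + 1)
  have w0 : P.area a b c ≤ P.area a b (c + 1) := by
    by_cases e : c + 1 = c'
    · rw [e]; exact T.max₂ c
    by_contra! h
    have := (P.isAffine_area a b).valley (x := c) (p := c + 1) (q := c') (b := a) (by omega)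
      (by omega) (by omega) (by omega) h.le (T.max₂ _)
    rw [area_left, area_rotate] at this
    have := P.area_pos (show b < c + 1 by omega) (show c + 1 < a by omega) u3
    linarith
  have k1 : P.area b (b + 1) c' ≤ P.area b (b + 1) a := by
    have := T.max₁ (b + 1); have := P.area_sub_area c' a (b + 1) b; linarith
  have pos : ∀ x, b + 1 < x → x < b + n → 0 < P.area b (b + 1) x :=
    fun x h h' => P.area_pos (by omega) h h'
  have k2 : P.area b (b + 1) c < P.area b (b + 1) c' := by
    by_contra! h
    have := aF.valley (x := c) (p := c') (q := a) (b := b + n) h2 u2 u3 (by omega) h k1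
    rw [aF.apply_add, area_left] at this
    linarith [pos c' (by omega) (by omega)]
  have k3 : 0 < P.turn b c := by
    rw [turn, sub_pos]
    by_cases e : c + 1 = c'
    · rwa [e]
    by_contra! h
    have := aF.valley (x := c) (p := c + 1) (q := c') (b := b + n) (by omega) (by omega) (by omega)
      (by omega) h (by linarith)
    rw [aF.apply_add, area_left] at this
    linarith [pos (c + 1) (by omega) (by omega)]
  refine ⟨k3, ?_⟩
  have key : P.area b c a * P.turn b c = P.area b (b + 1) a * P.area b c (c + 1) +
      (P.area a b (c + 1) - P.area a b c) * P.area b (b + 1) c := by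
    simp only [turn, area_eq]; ring
  have f0 := P.area_pos h1 (show c < c + 1 by omega) (by omega)
  have g0 := P.edge_area_nonneg b c
  rw [key]
  have := mul_lt_mul_of_pos_left (k2.trans_le k1) f0
  have := mul_nonneg (sub_nonneg.2 w0) g0
  linarith

/-- If `b', c, a'` is 3-stable with `b'` after `b`, then no vertex on the right of `bc` is further
than the point `I` of `(b, c)` from the line `bc`. -/
lemma StableTriple.not_beyond {b b' c a' : ℤ} (T : P.StableTriple b' c a') (h1 : b < b')
    (h2 : a' ≤ b + n) (hD : 0 < P.turn b c) (a : ℤ) :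
    P.area b c a * P.turn b c ≤ P.area b c (c + 1) * P.area b (b + 1) c := by
  obtain ⟨u1, u2, u3⟩ := And.intro T.lt₁ (And.intro T.lt₂ T.lt₃)
  have aF := P.isAffine_area b (b + 1)
  by_contra! h
  -- The height over `ca'` rises from `b` to `b + 1`, on the way to its maximum at `b'`. In the
  -- coordinates below this says that `a'` has nonpositive first coordinate; `hy1`, from the
  -- stability of `c`, bounds its second coordinate.
  have hx1 : P.area b (b + 1) a' ≤ P.area b (b + 1) c := by
    have e := P.area_sub_area b (b + 1) a' c
    suffices P.area c a' b ≤ P.area c a' (b + 1) by linarith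
    by_cases e : b + 1 = b'
    · have := T.max₁ b; rwa [e]
    have T1 := T.max₁
    by_contra! h
    have := (P.isAffine_area c a').valley (x := b) (p := b + 1) (q := b') (b := c) (by omega)
      (by omega) (by omega) (by omega) h.le (T1 _)
    rw [area_left] at this
    have h3 := P.area_pos u2 (show a' < b + 1 + n by omega) (by omega)
    rw [area_apex_add] at h3
    linarith
  have hy1 : P.area c (c + 1) a' ≤ P.area c (c + 1) b' := by
    have := T.max₂ (c + 1); have := P.area_sub_area a' b' (c + 1) c; linarith
  have hy2 := P.edge_area_nonneg c a
  have hA := T.max₃ a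
  have ha' : 0 < P.area c (c + 1) b' := by
    have := P.area_pos u1 (show c < c + 1 by omega) (by omega)
    rwa [area_rotate] at this
  have hb' : P.area b (b + 1) b' < P.area b (b + 1) c := by
    by_contra! hc
    have hc1 : P.area b (b + 1) c < P.area b (b + 1) (c + 1) := by rwa [turn, sub_pos] at hD
    have c0 := P.edge_area_nonneg b c
    rcases (show c + 1 ≤ b + n by omega).eq_or_lt with e | e
    · rw [e, area_apex_add, area_left] at hc1; linarith
    have := aF.valley (x := b') (p := c) (q := c + 1) (b := b + n) u1 (by omega) e (by omega) hc
      hc1.le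
    rw [aF.apply_add, area_left] at this
    have := P.area_pos (show b < b + 1 by omega) (show b + 1 < c by omega) (by omega)
    linarith
  have hbb := P.edge_area_nonneg b b'
  have hin : P.area b c b' ≤ 0 := P.area_nonpos (by omega) h1.le u1.le
  set D := P.turn b c with hD'
  -- coordinates in the basis given by the edges `c` and `-b`, with origin `c`
  obtain ⟨x₁, ex₁⟩ : ∃ x, x = P.area b (b + 1) a' - P.area b (b + 1) c := ⟨_, rfl⟩
  obtain ⟨x₂, ex₂⟩ : ∃ x, x = P.area b (b + 1) a - P.area b (b + 1) c := ⟨_, rfl⟩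
  obtain ⟨v, ev⟩ : ∃ x, x = P.area b (b + 1) c - P.area b (b + 1) b' := ⟨_, rfl⟩
  have c1 : P.area b c a * D = P.area c (c + 1) b * x₂ + P.area b (b + 1) c * P.area c (c + 1) a := by
    rw [ex₂]; simp only [hD', turn, area_eq]; ring
  have c2 : P.area b' c a * D = P.area c (c + 1) b' * x₂ + v * P.area c (c + 1) a := by
    rw [ex₂, ev]; simp only [hD', turn, area_eq]; ring
  have c3 : P.area b' c a' * D = P.area c (c + 1) b' * x₁ + v * P.area c (c + 1) a' := by
    rw [ex₁, ev]; simp only [hD', turn, area_eq]; ring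
  have c4 : P.area b c b' * D =
      P.area b (b + 1) c * P.area c (c + 1) b' - P.area c (c + 1) b * v := by
    rw [ev]; simp only [hD', turn, area_eq]; ring
  have c5 : P.area b c (c + 1) = P.area c (c + 1) b := P.area_rotate _ _ _
  rw [c5, c1] at h
  have i1 : P.area b c b' * D ≤ 0 := mul_nonpos_of_nonpos_of_nonneg hin hD.le
  have i2 := mul_le_mul_of_nonneg_right hA hD.le
  rw [c4] at i1
  rw [c2, c3] at i2
  have hv : 0 < v := by linarith
  have hvg : v ≤ P.area b (b + 1) c := by linarith
  have hx : x₁ ≤ 0 := by linarith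
  generalize P.area c (c + 1) b = α at *
  generalize P.area b (b + 1) c = β at *
  generalize P.area c (c + 1) b' = α' at *
  generalize P.area c (c + 1) a = y₂ at *
  generalize P.area c (c + 1) a' = y₁ at *
  -- Up to scaling, `I` is `(0, α)`, `b` is `(-β, α)`, `b'` is `(-v, α')`, and the heights over `bc`
  -- and `b'c` are `α x + β y` and `α' x + v y`. The contradiction comes from the chain `α' (α x₂ +
  -- β y₂) ≤ α (α' x₂ + v y₂) ≤ α v α' ≤ α β α'`. Its steps use that `b'` is not to the right of
  -- `bc`, the stability of `a'`, and `v ≤ β`.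
  have j0 : 0 < α := by
    have : 0 < α * v := lt_of_lt_of_le (mul_pos (hv.trans_le hvg) ha') (by linarith)
    exact pos_of_mul_pos_left this hv.le
  have j1 := mul_le_mul_of_nonneg_right (show β * α' ≤ α * v by linarith) hy2
  have j2 := mul_lt_mul_of_pos_left h ha'
  have j3 := mul_le_mul_of_nonneg_left hvg (mul_pos j0 ha').le
  have j4 := mul_le_mul_of_nonneg_left hy1 hv.le
  have j5 := mul_nonpos_of_nonneg_of_nonpos ha'.le hx
  have j6 := mul_le_mul_of_nonneg_left (show α' * x₂ + v * y₂ ≤ v * α' by linarith) j0.le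
  nlinarith [j1, j2, j3, j6]

/-! ## The furthest vertex while the line rotates -/

variable (P) in
/-- Advancing `b` keeps the vertices before the furthest one on the rising side. -/
lemma area_lt_of_left {b b' c p a : ℤ} (h1 : b < b') (h2 : b' < c) (h3 : c ≤ p) (h4 : p < a)
    (h5 : a < b + n) (h : P.area b c p ≤ P.area b c a) : P.area b' c p < P.area b' c a := by
  rcases h3.eq_or_lt with rfl | h3
  · rw [area_right]
    exact P.area_pos h2 h4 (by omega)
  -- The three-term Plücker relation for the vectors from `c` to `b`, `b'`, `p`, `a`. The last
  -- product is positive, which makes the conclusion strict even when the hypothesis is an equality.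
  have key : P.area b c p * (P.area b' c a - P.area b' c p) =
      P.area b' c p * (P.area b c a - P.area b c p) + P.area b b' c * P.area c p a := by
    simp only [area_eq]; ring
  have e1 := P.area_pos (show b < c by omega) h3 (by omega)
  have e2 := P.area_pos h2 h3 (by omega)
  have e3 := mul_pos (P.area_pos h1 h2 (by omega)) (P.area_pos h3 h4 (by omega))
  have e4 := mul_nonneg e2.le (sub_nonneg.2 h)
  exact sub_pos.1 (pos_of_mul_pos_right (show 0 < P.area b c p * _ by linarith) e1.le)

variable (P) in
/-- Advancing `c` keeps the vertices before the furthest one on the rising side. -/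
lemma area_lt_of_right {b c c' p a : ℤ} (h1 : b < c) (h2 : c < c') (h3 : c' ≤ p) (h4 : p < a)
    (h5 : a < b + n) (h : P.area b c p ≤ P.area b c a) : P.area b c' p < P.area b c' a := by
  rcases h3.eq_or_lt with rfl | h3
  · rw [area_right]
    exact P.area_pos (by omega) h4 h5
  have key : (P.area b c p - P.area b c c') * (P.area b c' a - P.area b c' p) =
      P.area b c' p * (P.area b c a - P.area b c p) + P.area b c c' * P.area c' p a := by
    simp only [area_eq]; ring
  have e1 := P.area_pos h1 (show c < p by omega) (by omega)
  have e2 := P.area_pos (show b < c' by omega) h3 (by omega)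
  have e3 := mul_pos (P.area_pos h1 h2 (by omega)) (P.area_pos h3 h4 (by omega))
  have e4 := mul_nonneg e2.le (sub_nonneg.2 h)
  have e5 : P.area b c c' ≤ P.area b c p := by
    by_contra! hc
    have := (P.isAffine_area b c).valley (b := b + n) h3 h4 h5 (by omega) hc.le h
    rw [area_apex_add, area_left] at this
    linarith
  exact sub_pos.1 (pos_of_mul_pos_right
    (show 0 < (P.area b c p - P.area b c c') * _ by linarith) (sub_nonneg.2 e5))

variable (P) in
-- Local maximality suffices. In the case `a = c`, a successor that is not higher means that no
-- vertex at all lies to the right of `bc`.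
lemma area_le_of_neighbors {b c a : ℤ} (h1 : b < c) (h2 : c ≤ a) (h3 : a < b + n)
    (h : P.area b c (a + 1) ≤ P.area b c a) (h' : a = c ∨ P.area b c (a - 1) ≤ P.area b c a)
    (x : ℤ) : P.area b c x ≤ P.area b c a := by
  rcases h' with rfl | h'
  · rw [area_right] at h ⊢
    obtain ⟨y, hy1, hy2, hy3⟩ := P.exists_lift_eq x b
    have e : P.area b a x = P.area b a y := by rw [area, area, hy3]
    rw [e]
    by_contra! hy
    have := P.lt_of_area_pos h3 hy1 hy
    have := P.area_pos h1 (show a < a + 1 by omega) (by omega)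
    linarith
  · exact (P.isAffine_area b c).le_of_neighbors h' h x

variable (P) in
/-- At most two vertices are furthest from a line, and then they are neighbours. -/
lemma eq_add_one_of_max {b c a i : ℤ} (h1 : b < c) (h2 : c < i) (h3 : i < a) (h4 : a < b + n)
    (hi : ∀ x, P.area b c x ≤ P.area b c i) (ha : ∀ x, P.area b c x ≤ P.area b c a) :
    a = i + 1 := by
  by_contra h
  have := (P.isAffine_area b c).valley (x := i) (p := i + 1) (q := a) (b := b + n) (by omega)
    (by omega) h4 (by omega) (hi _) (ha _)
  rw [area_apex_add, area_left] at this
  have := P.area_pos h1 (show c < i + 1 by omega) (by omega)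
  linarith

/-- If the height rises strictly into `a`, then `a` is the first of at most two furthest vertices.
This is why reporting tests only `A` and `A + 1`. -/
lemma StableTriple.apex_eq {b c a i : ℤ} (T : P.StableTriple b c i) (h1 : c ≤ a) (h2 : a < b + n)
    (ha : ∀ x, P.area b c x ≤ P.area b c a) (h : a = c ∨ P.area b c (a - 1) < P.area b c a) :
    i = a ∨ i = a + 1 := by
  obtain ⟨u1, u2, u3⟩ := And.intro T.lt₁ (And.intro T.lt₂ T.lt₃)
  have hi := P.area_pos u1 u2 u3
  rcases h with rfl | h
  · have := ha i
    rw [area_right] at this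
    linarith
  rcases lt_trichotomy i a with h3 | h3 | h3
  · have e := P.eq_add_one_of_max u1 u2 h3 h2 T.max₃ ha
    have := T.max₃ a
    rw [show a - 1 = i by omega] at h
    linarith
  · exact .inl h3
  · have hc : c < a := by
      rcases h1.eq_or_lt with e | e
      · subst e
        have := ha i
        rw [area_right] at this
        linarith
      · exact e
    exact .inr (P.eq_add_one_of_max u1 hc h3 u3 ha T.max₃)

/-- The substitute for `apex_eq` at pairs where a strict rise into the known apex is not available.
-/
lemma StableTriple.apex_near {b c a i : ℤ} (T : P.StableTriple b c i) (T' : P.StableTriple b c a) :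
    i = a ∨ i = a + 1 ∨ i = a - 1 := by
  rcases lt_trichotomy i a with h | h | h
  · have := P.eq_add_one_of_max T.lt₁ T.lt₂ h T'.lt₃ T.max₃ T'.max₃
    omega
  · exact .inl h
  · exact .inr (.inl (P.eq_add_one_of_max T.lt₁ T'.lt₂ h T.lt₃ T'.max₃ T.max₃))

/-! ## Killing -/

variable (P) in
-- The apex of such a triangle would be beyond `I`, and the furthest vertex `a` is at least as far.
lemma not_stableTriple_of_not_beyondI {b c a : ℤ} (h1 : b < c) (h2 : c < b + n)
    (ha : ∀ x, P.area b c x ≤ P.area b c a) (h : ¬ P.BeyondI a b c) {c' i : ℤ} (hc : c < c') :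
    ¬ P.StableTriple b c' i := fun T => h <| by
  obtain ⟨hD, hI⟩ := T.beyond h1 hc
  rw [P.beyondI_iff h1 h2]
  refine ⟨hD, hI.trans_le ?_⟩
  exact mul_le_mul_of_nonneg_right ((ha i).trans (le_abs_self _)) hD.le

/-- `exists_apex` replaces the apex by one at most `s + n ≤ b + n`, as `not_beyond` requires. -/
lemma StableTriple.not_stableTriple_of_beyondI {s t r b c a : ℤ} (T : P.StableTriple s t r)
    (hb : s ≤ b) (hc : t ≤ c) (hc' : c ≤ r) (h1 : b < c) (ha : c ≤ a) (ha' : a ≤ b + n)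
    (h : P.BeyondI a b c) {b' i : ℤ} (hb' : b < b') (hb'' : b' ≤ t) :
    ¬ P.StableTriple b' c i := fun T' => by
  have := T.lt₃
  rw [P.beyondI_iff h1 (by omega), abs_of_nonneg (P.area_nonneg h1 ha ha')] at h
  obtain ⟨i', hi, T''⟩ := T.exists_apex T' hb'' hc hc'
  have := T''.not_beyond hb' (by omega) h.1 a
  linarith [h.2]

variable (P) in
-- Here `I` is the vertex `b` itself, at height zero. So `B` is never killed when `C` is its
-- successor, and `B` cannot run into `C`.
lemma beyondI_of_adjacent {b a : ℤ} (ha : ∀ x, P.area b (b + 1) x ≤ P.area b (b + 1) a) :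
    P.BeyondI a b (b + 1 : ℤ) := by
  have hn := P.three_le
  have := P.area_pos (show b < b + 1 by omega) (show b + 1 < b + 1 + 1 by omega) (by omega)
  have hD : 0 < P.turn b (b + 1) := by rw [turn, area_right]; linarith
  rw [P.beyondI_iff (by omega) (by omega), area_right, mul_zero]
  exact ⟨hD, mul_pos (abs_pos.2 (this.trans_le (ha _)).ne') hD⟩

variable (P) in
-- With `A = C` the height of `A` is zero, so `C` is not killed and cannot overtake `A`.
lemma not_beyondI_self {b c : ℤ} (h1 : b < c) (h2 : c < b + n) : ¬ P.BeyondI c b c := by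
  rw [P.beyondI_iff h1 h2, area_right, abs_zero, zero_mul]
  rintro ⟨-, h⟩
  have := mul_nonneg (P.area_nonneg h1 (show c ≤ c + 1 by omega) (by omega))
    (P.edge_area_nonneg b c)
  linarith

end ConvexPolygon

/-! ## The tests by real arithmetic -/

namespace Timed

variable {α β : Type}

@[simp] lemma val_bind (x : Timed α) (f : α → Timed β) : (x >>= f).val = (f x.val).val := rfl

@[simp] lemma time_bind (x : Timed α) (f : α → Timed β) :
    (x >>= f).time = x.time + (f x.val).time := rfl

@[simp] lemma val_pure (a : α) : (pure a : Timed α).val = a := rfl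

@[simp] lemma time_pure (a : α) : (pure a : Timed α).time = 0 := rfl

lemma time_ite_pure {p : Prop} [Decidable p] (a b : α) :
    (if p then pure a else pure b : Timed α).time = 0 := by
  split <;> rfl

@[simp] lemma val_tick (a : α) : (tick a).val = a := rfl

@[simp] lemma time_tick (a : α) : (tick a).time = 1 := rfl

end Timed

@[simp] lemma val_absR (x : ℝ) : (absR x).val = |x| := by
  by_cases h : x < 0
  · simp [absR, ltR, subR, h, abs_of_neg]
  · simp [absR, ltR, h, abs_of_nonneg (not_lt.1 h)]

lemma time_absR_le (x : ℝ) : (absR x).time ≤ 2 := by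
  by_cases h : x < 0 <;> simp [absR, ltR, subR, h]

@[simp] lemma val_crossR (u w : ℝ × ℝ) : (crossR u w).val = u.1 * w.2 - u.2 * w.1 := rfl

@[simp] lemma time_crossR (u w : ℝ × ℝ) : (crossR u w).time = 3 := rfl

@[simp] lemma val_ltR (x y : ℝ) : (ltR x y).val = decide (x < y) := rfl

@[simp] lemma time_ltR (x y : ℝ) : (ltR x y).time = 1 := rfl

@[simp] lemma val_mulR (x y : ℝ) : (mulR x y).val = x * y := rfl

@[simp] lemma time_mulR (x y : ℝ) : (mulR x y).time = 1 := rfl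

namespace ConvexPolygon

variable {n : ℕ} (P : ConvexPolygon n)

@[simp] lemma val_vecR (i j : ZMod n) : (P.vecR i j).val =
    (P.vertex j 0 - P.vertex i 0, P.vertex j 1 - P.vertex i 1) := rfl

@[simp] lemma time_vecR (i j : ZMod n) : (P.vecR i j).time = 6 := rfl

/-! ### Operation counts of the arithmetic tests -/

lemma time_areaR_le (B C X : ZMod n) : (P.areaR B C X).time ≤ 17 := by
  have := time_absR_le (P.vecR B C >>= fun x => P.vecR B X >>= fun y => crossR x y).val
  simp only [areaR, Timed.time_bind, Timed.val_bind, time_vecR, time_crossR] at *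
  omega

lemma time_fartherR_le (B C X Y : ZMod n) : (P.fartherR B C X Y).time ≤ 35 := by
  have := P.time_areaR_le B C X
  have := P.time_areaR_le B C Y
  simp only [fartherR, Timed.time_bind, time_ltR]
  omega

lemma time_cornerR_le (A B C : ZMod n) : (P.cornerR A B C).time ≤ 72 := by
  have := P.time_fartherR_le B C (A + 1) A
  have := P.time_fartherR_le B C (A - 1) A
  simp only [cornerR, Timed.time_bind, Timed.time_tick, Timed.val_tick, Timed.time_pure]
  omega

lemma time_threeStableR_le (A B C : ZMod n) : (P.threeStableR A B C).time ≤ 232 := by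
  have := P.time_cornerR_le A B C
  have := P.time_cornerR_le B C A
  have := P.time_cornerR_le C A B
  simp only [threeStableR, Timed.time_bind, time_vecR, time_crossR, time_ltR]
  split_ifs <;> simp only [Timed.time_bind, Timed.time_pure] <;> omega

lemma time_beyondIR_le (A B C : ZMod n) : (P.beyondIR A B C).time ≤ 100 := by
  have := P.time_areaR_le B C A
  simp only [beyondIR, Timed.time_bind, Timed.time_tick, Timed.val_tick, time_vecR, time_crossR,
    time_ltR]
  split_ifs
  · have := time_absR_le (P.vecR B C >>= fun x => P.vecR C (C + 1) >>= fun y => crossR x y).val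
    simp only [Timed.time_bind, Timed.val_bind, time_crossR, time_mulR, time_ltR] at *
    omega
  · simp only [Timed.time_pure]
    omega

lemma time_step_le (r t : ZMod n) (σ : Config n) : (step P.arithmeticTests r t σ).time ≤ 500 := by
  obtain ⟨ph, A, B, C, out⟩ := σ
  have h1 := P.time_fartherR_le B C (A + 1) A
  have h2 := P.time_threeStableR_le A B C
  have h3 := P.time_threeStableR_le (A + 1) B C
  have h4 := P.time_beyondIR_le A B C
  cases ph
  case check =>
    simp only [step, Timed.time_bind, Timed.time_tick]
    rw [Timed.time_ite_pure]
    omega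
  all_goals simp only [step, Timed.time_bind, Timed.time_tick, Timed.val_tick,
    Timed.time_pure, arithmeticTests]
  case report => split_ifs <;> simp only [Timed.time_bind, Timed.time_pure, Timed.time_tick] <;>
    split_ifs <;> simp only [Timed.time_bind, Timed.time_pure, Timed.time_tick] <;> omega
  case killB => omega
  case killC => omega
  case done => omega
  case scan => split_ifs <;> simp only [Timed.time_pure] <;> omega
  case choose => split_ifs <;> simp only [Timed.time_pure] <;> omega

lemma time_run_le (r s t : ZMod n) (k : ℕ) : (run P.arithmeticTests r s t k).time ≤ 500 * k := by
  induction k with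
  | zero => simp [run]
  | succ k ih =>
    have := P.time_step_le r t (run P.arithmeticTests r s t k).val
    simp only [run, Timed.time_bind]
    omega

/-! ### Agreement of the arithmetic tests with their geometric meaning -/

@[simp] lemma val_areaR (b c x : ℤ) : (P.areaR b c x).val = |P.area b c x| := by
  simp only [areaR, Timed.val_bind, val_absR, val_vecR, val_crossR]
  rw [← abs_neg, area_eq]
  congr 1
  simp only [lift]
  ring

lemma val_fartherR (b c x y : ℤ) :
    (P.fartherR b c x y).val = decide (|P.area b c y| < |P.area b c x|) := by
  simp only [fartherR, Timed.val_bind, val_ltR, val_areaR]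

/-- Both neighbours of `a` are still in the arc from `c` to `b + n`, so the absolute values computed
are the signed areas, and unimodality makes the two comparisons sufficient. -/
lemma val_cornerR {b c a : ℤ} (h1 : b < c) (h2 : c < a) (h3 : a < b + n) :
    (P.cornerR a b c).val = true ↔ ∀ x, P.area b c x ≤ P.area b c a := by
  have e1 : (a : ZMod n) + 1 = (a + 1 : ℤ) := by push_cast; rfl
  have e2 : (a : ZMod n) - 1 = (a - 1 : ℤ) := by push_cast; rfl
  simp only [cornerR, Timed.val_bind, Timed.val_tick, Timed.val_pure, e1, e2, val_fartherR]
  rw [abs_of_nonneg (P.area_nonneg h1 h2.le h3.le),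
    abs_of_nonneg (P.area_nonneg h1 (show c ≤ a + 1 by omega) (by omega)),
    abs_of_nonneg (P.area_nonneg h1 (show c ≤ a - 1 by omega) (by omega))]
  simp only [Bool.and_eq_true, Bool.not_eq_true', decide_eq_false_iff_not, not_lt]
  exact ⟨fun h => (P.isAffine_area b c).le_of_neighbors h.2 h.1, fun h => ⟨h _, h _⟩⟩

/-- The degenerate positions `a = c` and `a = b + n` are allowed because the process may test `A =
C` or `A + 1 = B`; there both sides are false. -/
lemma val_threeStableR {b c a : ℤ} (h1 : b < c) (h3 : c ≤ a) (h4 : a ≤ b + n) :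
    (P.threeStableR a b c).val = true ↔ P.ThreeStable a b c := by
  have hcross : ((P.vertex c 0 - P.vertex b 0) * (P.vertex a 1 - P.vertex b 1) -
      (P.vertex c 1 - P.vertex b 1) * (P.vertex a 0 - P.vertex b 0)) = -P.area b c a := by
    rw [area_eq]; simp only [lift]; ring
  simp only [threeStableR, Timed.val_bind, val_vecR, val_crossR, val_ltR, hcross]
  by_cases ha : 0 < P.area b c a
  · have h5 : c < a := by
      rcases h3.eq_or_lt with rfl | h
      · simp at ha
      · exact h
    have h6 : a < b + n := by
      rcases h4.eq_or_lt with rfl | h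
      · simp at ha
      · exact h
    have c1 := P.val_cornerR h1 h5 h6
    have c2 := P.val_cornerR h5 h6 (show b + n < c + n by omega)
    have c3 := P.val_cornerR h6 (show b + n < c + n by omega) (by omega)
    have cast_add : ∀ x : ℤ, ((x + n : ℤ) : ZMod n) = x := fun x => by simp
    simp only [cast_add, area_apex_add, area_right_add] at c2 c3
    simp only [neg_lt_zero, ha, decide_true, if_true, Timed.val_bind, Timed.val_pure,
      Bool.and_eq_true, c1, c2, c3]
    have T : P.ThreeStable a b c ↔ P.ThreeStable b c a :=
      ⟨fun h => h.rotate, fun h => h.rotate.rotate⟩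
    rw [T, P.threeStable_iff h1 h5 h6]
    exact ⟨fun ⟨⟨h, h'⟩, h''⟩ => ⟨h1, h5, h6, h', h'', h⟩, fun h => ⟨⟨h.max₃, h.max₁⟩, h.max₂⟩⟩
  · simp only [neg_lt_zero, ha, decide_false, Bool.false_eq_true, if_false, Timed.val_pure,
      false_iff]
    intro h
    have h0 : cross (P.lift c - P.lift b) (P.lift a - P.lift b) < 0 := h.1.1
    rw [neg_cross_eq_area] at h0
    linarith

lemma val_beyondIR {b c : ℤ} (h1 : b < c) (h2 : c < b + n) (a : ℤ) :
    (P.beyondIR a b c).val = true ↔ P.BeyondI a b c := by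
  have e1 : (b : ZMod n) + 1 = (b + 1 : ℤ) := by push_cast; rfl
  have e2 : (c : ZMod n) + 1 = (c + 1 : ℤ) := by push_cast; rfl
  have hD : (P.vertex (c + 1 : ℤ) 0 - P.vertex c 0) * (P.vertex (b + 1 : ℤ) 1 - P.vertex b 1) -
      (P.vertex (c + 1 : ℤ) 1 - P.vertex c 1) * (P.vertex (b + 1 : ℤ) 0 - P.vertex b 0) =
      P.turn b c := by
    simp only [turn, area_eq, lift]; ring
  have hC : (P.vertex c 0 - P.vertex b 0) * (P.vertex (c + 1 : ℤ) 1 - P.vertex c 1) -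
      (P.vertex c 1 - P.vertex b 1) * (P.vertex (c + 1 : ℤ) 0 - P.vertex c 0) =
      -P.area b c (c + 1) := by
    simp only [area_eq, lift]; ring
  have hB : (P.vertex c 0 - P.vertex b 0) * (P.vertex (b + 1 : ℤ) 1 - P.vertex b 1) -
      (P.vertex c 1 - P.vertex b 1) * (P.vertex (b + 1 : ℤ) 0 - P.vertex b 0) =
      P.area b (b + 1) c := by
    simp only [area_eq, lift]
  rw [P.beyondI_iff h1 h2]
  simp only [beyondIR, Timed.val_bind, Timed.val_tick, e1, e2, val_vecR, val_crossR, val_ltR,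
    hD, decide_eq_true_eq]
  split_ifs with h
  · simp only [Timed.val_bind, val_areaR, val_absR, val_crossR, val_mulR, val_ltR, hC, hB, abs_neg,
      abs_of_nonneg (P.area_nonneg h1 (show c ≤ c + 1 by omega) (by omega)), decide_eq_true_eq, h,
      true_and]
  · simp [h]

end ConvexPolygon

lemma step_congr {n : ℕ} {T T' : Tests n} {σ : Config n}
    (h1 : (T.farther σ.B σ.C (σ.A + 1) σ.A).val = (T'.farther σ.B σ.C (σ.A + 1) σ.A).val)
    (h2 : (T.threeStable σ.A σ.B σ.C).val = (T'.threeStable σ.A σ.B σ.C).val)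
    (h3 : (T.threeStable (σ.A + 1) σ.B σ.C).val = (T'.threeStable (σ.A + 1) σ.B σ.C).val)
    (h4 : (T.beyondI σ.A σ.B σ.C).val = (T'.beyondI σ.A σ.B σ.C).val) (r t : ZMod n) :
    (step T r t σ).val = (step T' r t σ).val := by
  obtain ⟨ph, A, B, C, out⟩ := σ
  cases ph <;> simp only [step, Timed.val_bind, Timed.val_tick] at * <;> simp only [h1, h2, h4]
  split_ifs <;> simp only [Timed.val_bind, h3]

namespace ConvexPolygon

variable {n : ℕ} (P : ConvexPolygon n)

lemma step_arithmetic_eq {a b c : ℤ} (h1 : b < c) (h2 : c < b + n) (h3 : c ≤ a) (h4 : a < b + n)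
    {σ : Config n} (hA : σ.A = a) (hB : σ.B = b) (hC : σ.C = c) (r t : ZMod n) :
    (step P.arithmeticTests r t σ).val = (step P.geometricTests r t σ).val := by
  have e1 : (a : ZMod n) + 1 = (a + 1 : ℤ) := by push_cast; rfl
  apply step_congr <;> rw [hA, hB, hC] <;> simp only [e1, arithmeticTests, geometricTests,
    Timed.val_tick]
  · rw [val_fartherR, decide_eq_decide, P.farther_iff h1 h2]
  · rw [Bool.eq_iff_iff, P.val_threeStableR h1 h3 h4.le]
    simp only [decide_eq_true_eq]
  · rw [Bool.eq_iff_iff, P.val_threeStableR h1 (by omega) (by omega)]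
    simp only [decide_eq_true_eq]
  · rw [Bool.eq_iff_iff, P.val_beyondIR h1 h2]
    simp only [decide_eq_true_eq]

end ConvexPolygon

/-! ## The invariant of the process -/

variable {n : ℕ}

/-- The number of the phase within an iteration. -/
def Phase.rank : Phase → ℤ
  | .scan => 0
  | .report => 1
  | .check => 2
  | .choose => 3
  | .killB => 4
  | .killC => 4
  | .done => 3

lemma Listed.mono {L L' : List (ZMod n × ZMod n × ZMod n)} {i j k : ZMod n} (h : Listed L i j k)
    (hL : ∀ x ∈ L, x ∈ L') : Listed L' i j k :=
  h.imp (hL _) (Or.imp (hL _) (hL _))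

lemma Listed.rotate {L : List (ZMod n × ZMod n × ZMod n)} {i j k : ZMod n} (h : Listed L i j k) :
    Listed L j k i := by
  rcases h with h | h | h
  exacts [.inr (.inr h), .inl h, .inr (.inl h)]

lemma Listed.of_eq {L : List (ZMod n × ZMod n × ZMod n)} {i j k i' j' k' : ZMod n}
    (h : Listed L i' j' k')
    (e : (i', j', k') = (i, j, k) ∨ (i', j', k') = (j, k, i) ∨ (i', j', k') = (k, i, j)) :
    Listed L i j k := by
  rcases e with e | e | e <;> cases e
  exacts [h, h.rotate.rotate, h.rotate]

namespace ConvexPolygon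

variable (P : ConvexPolygon n)

/-- What holds after `m` steps, in terms of integer pointers `a, b, c`. -/
structure Invariant (s t r m : ℤ) (σ : Config n) (a b c : ℤ) : Prop where
  A_eq : σ.A = a
  B_eq : σ.B = b
  C_eq : σ.C = c
  le_b : s ≤ b
  b_le : b ≤ t
  le_c : t ≤ c
  c_le : c ≤ r
  b_lt_c : b < c
  c_le_a : c ≤ a
  a_lt : a < b + n
  -- The last alternative is the start: `r` is furthest because it is stable, but it may tie with `r
  -- - 1`.
  rising : a = c ∨ P.area b c (a - 1) < P.area b c a ∨ b = s ∧ c = t ∧ a = r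
  top : σ.phase ≠ .scan → P.area b c (a + 1) ≤ P.area b c a
  not_end : σ.phase = .choose ∨ σ.phase = .killB ∨ σ.phase = .killC → ¬ (b = t ∧ c = r)
  at_end : σ.phase = .done → b = t ∧ c = r
  not_beyond : σ.phase = .killB → ¬ P.BeyondI a b c
  beyond : σ.phase = .killC → P.BeyondI a b c
  -- Every step raises the left side by one: a pointer move of `A` by one, a phase change by one in
  -- rank, and a kill by `5 - 4`.
  potential : σ.phase ≠ .done → a + 5 * (b + c) + σ.phase.rank = r + 5 * (s + t) + m
  sound : ∀ x ∈ σ.out, P.ThreeStable x.1 x.2.1 x.2.2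
  -- Each triangle is already output, or its pair is still ahead of both pointers, or it is the one
  -- that the initial pair may miss.
  listed : ∀ j k i : ℤ, P.StableTriple j k i → s ≤ j → j ≤ t → t ≤ k → k ≤ r →
    Listed σ.out i j k ∨ (b ≤ j ∧ c ≤ k) ∨ (j = s ∧ k = t ∧ i = r - 1)
  reported : σ.phase ≠ .scan → σ.phase ≠ .report → ∀ i : ℤ, P.StableTriple b c i →
    Listed σ.out i b c ∨ (b = s ∧ c = t ∧ i = r - 1)

variable {P} {s t r m a b c : ℤ} {σ : Config n}

lemma StableTriple.invariant_init (T : P.StableTriple s t r) :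
    P.Invariant s t r 0 (init (r : ZMod n) s t) r s t where
  A_eq := rfl
  B_eq := rfl
  C_eq := rfl
  le_b := le_rfl
  b_le := T.lt₁.le
  le_c := le_rfl
  c_le := T.lt₂.le
  b_lt_c := T.lt₁
  c_le_a := T.lt₂.le
  a_lt := T.lt₃
  rising := by simp
  top := fun h => (h rfl).elim
  not_end := by simp [init]
  at_end := by simp [init]
  not_beyond := by simp [init]
  beyond := by simp [init]
  potential := by simp [init, Phase.rank]
  sound := by simp [init]
  listed := fun j k i _ h1 _ h2 _ => .inr (.inl ⟨h1, h2⟩)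
  reported := fun h => (h rfl).elim

namespace Invariant

lemma max (T : P.StableTriple s t r) (I : P.Invariant s t r m σ a b c) (h : σ.phase ≠ .scan)
    (x : ℤ) : P.area b c x ≤ P.area b c a := by
  rcases I.rising with h' | h' | ⟨rfl, rfl, rfl⟩
  · exact P.area_le_of_neighbors I.b_lt_c I.c_le_a I.a_lt (I.top h) (.inl h') x
  · exact P.area_le_of_neighbors I.b_lt_c I.c_le_a I.a_lt (I.top h) (.inr h'.le) x
  · exact T.max₃ x

lemma rising_le (T : P.StableTriple s t r) (I : P.Invariant s t r m σ a b c) :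
    a = c ∨ P.area b c (a - 1) ≤ P.area b c a := by
  rcases I.rising with h | h | ⟨rfl, rfl, rfl⟩
  exacts [.inl h, .inr h.le, .inr (T.max₃ _)]

lemma c_lt (T : P.StableTriple s t r) (I : P.Invariant s t r m σ a b c) : c < b + n := by
  have := T.lt₃; have := I.c_le; have := I.le_b; omega

/-- When `b` is about to be killed, it forms no 3-stable triangle with a later `c`. -/
lemma dead_of_killB (T : P.StableTriple s t r) (I : P.Invariant s t r m σ a b c)
    (h : σ.phase = .killB) {c' i : ℤ} (hc : c < c') : ¬ P.StableTriple b c' i :=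
  P.not_stableTriple_of_not_beyondI I.b_lt_c (I.c_lt T) (I.max T (by simp [h])) (I.not_beyond h) hc

/-- When `c` is about to be killed, it forms no 3-stable triangle with a later `b`. -/
lemma dead_of_killC (T : P.StableTriple s t r) (I : P.Invariant s t r m σ a b c)
    (h : σ.phase = .killC) {b' i : ℤ} (hb : b < b') (hb' : b' ≤ t) : ¬ P.StableTriple b' c i :=
  T.not_stableTriple_of_beyondI I.le_b I.le_c I.c_le I.b_lt_c I.c_le_a I.a_lt.le (I.beyond h) hb hb'

lemma scan (I : P.Invariant s t r m σ a b c) (h : σ.phase = .scan) :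
    ∃ a', P.Invariant s t r (m + 1) (step P.geometricTests r t σ).val a' b c := by
  have hc : c < b + n := by have := I.c_le_a; have := I.a_lt; omega
  have e : σ.A + 1 = (a + 1 : ℤ) := by rw [I.A_eq]; push_cast; rfl
  have hf : P.Farther σ.B σ.C (σ.A + 1) σ.A ↔ P.area b c a < P.area b c (a + 1) := by
    rw [e, I.A_eq, I.B_eq, I.C_eq, P.farther_iff I.b_lt_c hc,
      abs_of_nonneg (P.area_nonneg I.b_lt_c I.c_le_a I.a_lt.le),
      abs_of_nonneg (P.area_nonneg I.b_lt_c (by have := I.c_le_a; omega)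
        (by have := I.a_lt; omega))]
  have hp := I.potential (by simp [h])
  simp only [h, Phase.rank] at hp
  by_cases hF : P.Farther σ.B σ.C (σ.A + 1) σ.A
  · have hs : (step P.geometricTests (r : ZMod n) t σ).val = { σ with A := σ.A + 1 } := by
      simp [step, h, geometricTests, hF]
    have hlt := hf.1 hF
    -- `A` cannot reach `B`, since the height would have to rise to zero from a nonnegative value.
    have hne : a + 1 ≠ b + n := fun e' => by
      have := P.area_nonneg I.b_lt_c I.c_le_a I.a_lt.le
      rw [e', area_apex_add, area_left] at hlt
      linarith
    have := I.a_lt; have := I.c_le_a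
    rw [hs]
    exact ⟨a + 1,
      { I with
        A_eq := e
        c_le_a := by omega
        a_lt := by omega
        rising := .inr (.inl (by simpa using hlt))
        top := fun h' => (h' h).elim
        not_end := by simp [h]
        at_end := by simp [h]
        not_beyond := by simp [h]
        beyond := by simp [h]
        potential := fun _ => by simp only [h, Phase.rank]; omega
        reported := fun h' => (h' h).elim }⟩
  · have hs : (step P.geometricTests (r : ZMod n) t σ).val = { σ with phase := .report } := by
      simp [step, h, geometricTests, hF]
    rw [hs]
    exact ⟨a,
      { I with
        top := fun _ => not_lt.1 (hf.not.1 hF)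
        not_end := by simp
        at_end := by simp
        not_beyond := by simp
        beyond := by simp
        potential := fun _ => by simp only [Phase.rank]; omega
        reported := by simp }⟩

lemma report (T : P.StableTriple s t r) (I : P.Invariant s t r m σ a b c)
    (h : σ.phase = .report) :
    P.Invariant s t r (m + 1) (step P.geometricTests r t σ).val a b c := by
  obtain ⟨out, hs, h1, h2, h3, h4⟩ : ∃ out,
      (step P.geometricTests (r : ZMod n) t σ).val = { σ with phase := .check, out := out } ∧
      (∀ x ∈ σ.out, x ∈ out) ∧ (∀ x ∈ out, P.ThreeStable x.1 x.2.1 x.2.2) ∧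
      (P.ThreeStable σ.A σ.B σ.C → (σ.A, σ.B, σ.C) ∈ out) ∧
      (P.ThreeStable (σ.A + 1) σ.B σ.C → (σ.A + 1, σ.B, σ.C) ∈ out) := by
    have sound := I.sound
    by_cases u : P.ThreeStable σ.A σ.B σ.C <;>
      by_cases v : P.ThreeStable (σ.A + 1) σ.B σ.C <;>
      simp only [step, h, geometricTests, Timed.val_bind, Timed.val_tick, u, v, decide_true,
        decide_false, if_true, if_false, Bool.false_eq_true, Timed.val_pure] <;>
      refine ⟨_, rfl, ?_⟩ <;> simp_all
  have hp := I.potential (by simp [h])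
  simp only [h, Phase.rank] at hp
  have hmax := I.max T (by simp [h])
  rw [hs]
  exact
    { I with
      top := fun _ => I.top (by simp [h])
      not_end := by simp
      at_end := by simp
      not_beyond := by simp
      beyond := by simp
      potential := fun _ => by simp only [Phase.rank]; omega
      sound := h2
      listed := fun j k i T' e1 e2 e3 e4 =>
        (I.listed j k i T' e1 e2 e3 e4).imp_left fun hl => hl.mono h1
      reported := fun _ _ i T' => by
        have listed_a : i = a → Listed out i b c := by
          rintro rfl
          have := T'.rotate'.threeStable
          have e : ((i - n : ℤ) : ZMod n) = i := by simp
          rw [e, ← I.A_eq, ← I.B_eq, ← I.C_eq] at this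
          rw [← I.A_eq, ← I.B_eq, ← I.C_eq]
          exact .inl (h3 this)
        have listed_succ : i = a + 1 → Listed out i b c := by
          intro hi
          have := T'.rotate'.threeStable
          have e : ((i - n : ℤ) : ZMod n) = i := by simp
          have e' : (i : ZMod n) = σ.A + 1 := by rw [hi, I.A_eq]; push_cast; rfl
          rw [e, e', ← I.B_eq, ← I.C_eq] at this
          rw [e', ← I.B_eq, ← I.C_eq]
          exact .inl (h4 this)
        rcases or_assoc.2 I.rising with h' | ⟨rfl, rfl, rfl⟩
        · rcases T'.apex_eq I.c_le_a I.a_lt hmax h' with hi | hi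
          exacts [.inl (listed_a hi), .inl (listed_succ hi)]
        · rcases T'.apex_near T with hi | hi | hi
          exacts [.inl (listed_a hi), .inl (listed_succ hi), .inr ⟨rfl, rfl, hi⟩] }

lemma check (T : P.StableTriple s t r) (I : P.Invariant s t r m σ a b c)
    (h : σ.phase = .check) :
    P.Invariant s t r (m + 1) (step P.geometricTests r t σ).val a b c := by
  have := T.lt₁; have := T.lt₂; have := T.lt₃
  have := I.le_b; have := I.b_le; have := I.le_c; have := I.c_le
  have hb : σ.B = (t : ZMod n) ↔ b = t := by
    rw [I.B_eq]
    exact ⟨fun e => P.cast_inj e (by omega) (by omega), fun e => by rw [e]⟩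
  have hc : σ.C = (r : ZMod n) ↔ c = r := by
    rw [I.C_eq]
    exact ⟨fun e => P.cast_inj e (by omega) (by omega), fun e => by rw [e]⟩
  have hp := I.potential (by simp [h])
  simp only [h, Phase.rank] at hp
  by_cases he : b = t ∧ c = r
  · have hs : (step P.geometricTests (r : ZMod n) t σ).val = { σ with phase := .done } := by
      simp [step, h, hb, hc, he]
    rw [hs]
    exact
      { I with
        top := fun _ => I.top (by simp [h])
        not_end := by simp
        at_end := fun _ => he
        not_beyond := by simp
        beyond := by simp
        potential := by simp
        reported := fun _ _ => I.reported (by simp [h]) (by simp [h]) }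
  · have hs : (step P.geometricTests (r : ZMod n) t σ).val = { σ with phase := .choose } := by
      simp [step, h, hb, hc, he]
    rw [hs]
    exact
      { I with
        top := fun _ => I.top (by simp [h])
        not_end := fun _ => he
        at_end := by simp
        not_beyond := by simp
        beyond := by simp
        potential := fun _ => by simp only [Phase.rank]; omega
        reported := fun _ _ => I.reported (by simp [h]) (by simp [h]) }

lemma choose (I : P.Invariant s t r m σ a b c) (h : σ.phase = .choose) :
    P.Invariant s t r (m + 1) (step P.geometricTests r t σ).val a b c := by
  have hp := I.potential (by simp [h])
  simp only [h, Phase.rank] at hp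
  have hi : P.BeyondI σ.A σ.B σ.C ↔ P.BeyondI a b c := by rw [I.A_eq, I.B_eq, I.C_eq]
  by_cases hI : P.BeyondI σ.A σ.B σ.C
  · have hs : (step P.geometricTests (r : ZMod n) t σ).val = { σ with phase := .killC } := by
      simp [step, h, geometricTests, hI]
    rw [hs]
    exact
      { I with
        top := fun _ => I.top (by simp [h])
        not_end := fun _ => I.not_end (by simp [h])
        at_end := by simp
        not_beyond := by simp
        beyond := fun _ => hi.1 hI
        potential := fun _ => by simp only [Phase.rank]; omega
        reported := fun _ _ => I.reported (by simp [h]) (by simp [h]) }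
  · have hs : (step P.geometricTests (r : ZMod n) t σ).val = { σ with phase := .killB } := by
      simp [step, h, geometricTests, hI]
    rw [hs]
    exact
      { I with
        top := fun _ => I.top (by simp [h])
        not_end := fun _ => I.not_end (by simp [h])
        at_end := by simp
        not_beyond := fun _ => hi.not.1 hI
        beyond := by simp
        potential := fun _ => by simp only [Phase.rank]; omega
        reported := fun _ _ => I.reported (by simp [h]) (by simp [h]) }

lemma killB (T : P.StableTriple s t r) (I : P.Invariant s t r m σ a b c)
    (h : σ.phase = .killB) :
    P.Invariant s t r (m + 1) (step P.geometricTests r t σ).val a (b + 1) c := by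
  have hs : (step P.geometricTests (r : ZMod n) t σ).val =
      { σ with phase := .scan, B := σ.B + 1 } := by simp [step, h]
  have hp := I.potential (by simp [h])
  simp only [h, Phase.rank] at hp
  have := I.le_b; have := I.b_le; have := I.le_c; have := I.c_le; have := I.b_lt_c
  have := I.c_le_a; have := I.a_lt
  have hne := I.not_end (by simp [h])
  -- Killing `B = t` with `C` before `r` would make the pair `(t, r)` dead, but `s, t, r` is
  -- 3-stable.
  have hbt : b < t := by
    by_contra hb
    obtain rfl : b = t := by omega
    exact I.dead_of_killB T h (show c < r by omega) T.rotate
  have hbc : b + 1 < c := by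
    by_contra hb
    obtain rfl : c = b + 1 := by omega
    exact I.not_beyond h (P.beyondI_of_adjacent (I.max T (by simp [h])))
  rw [hs]
  exact
    { I with
      B_eq := by rw [I.B_eq]; push_cast; rfl
      le_b := by omega
      b_le := by omega
      b_lt_c := hbc
      a_lt := by omega
      -- A tie before the kill becomes a strict rise after it, so the exceptional alternative of the
      -- start does not persist.
      rising := by
        rcases I.rising_le T with e | e
        · exact .inl e
        by_cases hac : a = c
        · exact .inl hac
        · exact .inr (.inl (P.area_lt_of_left (by omega) hbc (by omega) (by omega) I.a_lt e))
      top := by simp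
      not_end := by simp
      at_end := by simp
      not_beyond := by simp
      beyond := by simp
      potential := fun _ => by simp only [Phase.rank]; omega
      listed := fun j k i T' e1 e2 e3 e4 => by
        rcases I.listed j k i T' e1 e2 e3 e4 with h' | ⟨h1, h2⟩ | h'
        · exact .inl h'
        · rcases h1.eq_or_lt with rfl | h1
          · rcases h2.eq_or_lt with rfl | h2
            · exact (I.reported (by simp [h]) (by simp [h]) i T').imp_right .inr
            · exact (I.dead_of_killB T h h2 T').elim
          · exact .inr (.inl ⟨h1, h2⟩)
        · exact .inr (.inr h')
      reported := by simp }

lemma killC (T : P.StableTriple s t r) (I : P.Invariant s t r m σ a b c)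
    (h : σ.phase = .killC) :
    P.Invariant s t r (m + 1) (step P.geometricTests r t σ).val a b (c + 1) := by
  have hs : (step P.geometricTests (r : ZMod n) t σ).val =
      { σ with phase := .scan, C := σ.C + 1 } := by simp [step, h]
  have hp := I.potential (by simp [h])
  simp only [h, Phase.rank] at hp
  have := I.le_b; have := I.b_le; have := I.le_c; have := I.c_le; have := I.b_lt_c
  have := I.c_le_a; have := I.a_lt
  have hne := I.not_end (by simp [h])
  have hcr : c < r := by
    by_contra hc
    obtain rfl : c = r := by omega
    exact I.dead_of_killC T h (show b < t by omega) le_rfl T.rotate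
  have hac : c ≠ a := fun hc => by
    have := I.beyond h
    rw [← hc] at this
    exact P.not_beyondI_self I.b_lt_c (I.c_lt T) this
  rw [hs]
  exact
    { I with
      C_eq := by rw [I.C_eq]; push_cast; rfl
      le_c := by omega
      c_le := by omega
      b_lt_c := by omega
      c_le_a := by omega
      rising := by
        by_cases hac' : a = c + 1
        · exact .inl hac'
        rcases I.rising_le T with e | e
        · exact (hac e.symm).elim
        · exact .inr (.inl (P.area_lt_of_right I.b_lt_c (by omega) (by omega) (by omega) I.a_lt e))
      top := by simp
      not_end := by simp
      at_end := by simp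
      not_beyond := by simp
      beyond := by simp
      potential := fun _ => by simp only [Phase.rank]; omega
      listed := fun j k i T' e1 e2 e3 e4 => by
        rcases I.listed j k i T' e1 e2 e3 e4 with h' | ⟨h1, h2⟩ | h'
        · exact .inl h'
        · rcases h2.eq_or_lt with rfl | h2
          · rcases h1.eq_or_lt with rfl | h1
            · exact (I.reported (by simp [h]) (by simp [h]) i T').imp_right .inr
            · exact (I.dead_of_killC T h h1 e2 T').elim
          · exact .inr (.inl ⟨h1, h2⟩)
        · exact .inr (.inr h')
      reported := by simp }

lemma done (I : P.Invariant s t r m σ a b c) (h : σ.phase = .done) :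
    P.Invariant s t r (m + 1) (step P.geometricTests r t σ).val a b c := by
  have hs : (step P.geometricTests (r : ZMod n) t σ).val = σ := by simp [step, h]
  rw [hs]
  exact { I with potential := fun h' => (h' h).elim }

lemma step (T : P.StableTriple s t r) (I : P.Invariant s t r m σ a b c) :
    ∃ a' b' c', P.Invariant s t r (m + 1) (step P.geometricTests r t σ).val a' b' c' := by
  cases h : σ.phase with
  | scan => exact (I.scan h).imp fun _ I' => ⟨_, _, I'⟩
  | report => exact ⟨_, _, _, I.report T h⟩
  | check => exact ⟨_, _, _, I.check T h⟩
  | choose => exact ⟨_, _, _, I.choose h⟩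
  | killB => exact ⟨_, _, _, I.killB T h⟩
  | killC => exact ⟨_, _, _, I.killC T h⟩
  | done => exact ⟨_, _, _, I.done h⟩

/-- When the pointers have reached `(t, r)`, every 3-stable triangle is listed, except possibly
the triangle `s - 1, t, r`. -/
lemma listed_or (T : P.StableTriple s t r) (I : P.Invariant s t r m σ a b c) (hb : b = t)
    (hc : c = r) {i j k : ZMod n} (h : P.ThreeStable i j k) :
    Listed σ.out i j k ∨ Listed [((s : ZMod n) - 1, (t : ZMod n), (r : ZMod n))] i j k := by
  subst hb hc
  have := T.lt₁; have := T.lt₂; have := T.lt₃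
  obtain ⟨j', k', i', T', h1, h2, h3, h4, e⟩ := T.interleave h
  rcases I.listed j' k' i' T' h1 h2 h3 h4 with h' | ⟨h5, h6⟩ | ⟨rfl, rfl, rfl⟩
  · exact .inl (h'.of_eq e)
  · obtain rfl : j' = b := by omega
    obtain rfl : k' = c := by omega
    -- A triangle on the pair `(t, r)` has its apex at `s` or next to it. The apexes `s` and `s + 1`
    -- were found earlier, through the pairs `(s, t)` and `(s + 1, t)`; only `s - 1` may be
    -- outstanding.
    rcases T'.apex_near T.rotate with rfl | rfl | rfl
    · refine .inl (Listed.of_eq ?_ e)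
      rcases I.listed _ _ _ T le_rfl (by omega) le_rfl (by omega) with h' | h' | h'
      · simpa using h'.rotate
      · omega
      · omega
    · refine .inl (Listed.of_eq ?_ e)
      have T'' := T'.rotate'
      rw [show s + n + 1 - n = s + 1 by ring] at T''
      rcases I.listed _ _ _ T'' (by omega) (by omega) le_rfl (by omega) with h' | h' | h'
      · simpa using h'.rotate
      · have := T''.lt₁; omega
      · omega
    · refine .inr (Listed.of_eq (.inl ?_) e)
      simp
  · have h6 := T'.lt₂
    -- The triangle `s, t, r - 1` is recovered through its pair `(t, r - 1)`, which the pointers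
    -- have already passed.
    rcases I.listed _ _ _ T'.rotate (by omega) le_rfl (by omega) (by omega) with h' | h' | h'
    · refine .inl (Listed.of_eq (Listed.rotate ?_) e)
      simpa using h'.rotate
    · omega
    · omega

/-- When the process has stopped, every 3-stable triangle is listed. -/
lemma listed_of_done (T : P.StableTriple s t r) (I : P.Invariant s t r m σ a b c)
    (hd : σ.phase = .done) {i j k : ZMod n} (h : P.ThreeStable i j k) : Listed σ.out i j k := by
  obtain ⟨rfl, rfl⟩ := I.at_end hd
  have := T.lt₁
  rcases I.listed_or T rfl rfl h with h' | h'
  · exact h'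
  have h0 : P.ThreeStable ((s : ZMod n) - 1) b c := by
    rcases h' with h' | h' | h' <;> simp only [List.mem_singleton, Prod.mk.injEq] at h' <;>
      obtain ⟨rfl, rfl, rfl⟩ := h'
    exacts [h, h.rotate, h.rotate.rotate]
  obtain ⟨k', i', e1, e2, T'⟩ := h0.exists_lift rfl
  have := T.lt₂; have := T.lt₃; have := T'.lt₁; have := T'.lt₂; have := T'.lt₃
  obtain rfl := P.cast_inj e1 (by omega) (by omega)
  rcases I.reported (by simp [hd]) (by simp [hd]) i' T' with h1 | h1
  · rw [e2] at h1
    refine h1.of_eq ?_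
    rcases h' with h' | h' | h' <;> simp only [List.mem_singleton, Prod.mk.injEq] at h' <;>
      obtain ⟨rfl, rfl, rfl⟩ := h' <;> simp
  · omega

end Invariant

end ConvexPolygon

namespace ConvexPolygon

variable {n : ℕ} {P : ConvexPolygon n} {s t r : ℤ}

/-! ## The run of the process -/

lemma config_succ (P : ConvexPolygon n) (r s t : ZMod n) (k : ℕ) :
    P.config r s t (k + 1) = (step P.geometricTests r t (P.config r s t k)).val := rfl

lemma StableTriple.exists_invariant (T : P.StableTriple s t r) (k : ℕ) :
    ∃ a b c, P.Invariant s t r k (P.config r s t k) a b c := by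
  induction k with
  | zero => exact ⟨_, _, _, T.invariant_init⟩
  | succ k ih =>
    obtain ⟨a, b, c, I⟩ := ih
    rw [config_succ, Nat.cast_succ]
    exact I.step T

lemma StableTriple.run_arithmetic (T : P.StableTriple s t r) (k : ℕ) :
    (run P.arithmeticTests (r : ZMod n) s t k).val = P.config r s t k := by
  induction k with
  | zero => rfl
  | succ k ih =>
    obtain ⟨a, b, c, I⟩ := T.exists_invariant k
    rw [config_succ, run, Timed.val_bind, ih]
    exact P.step_arithmetic_eq I.b_lt_c (I.c_lt T) I.c_le_a I.a_lt I.A_eq I.B_eq I.C_eq _ _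

/-- In the potential, `a - r` is less than `n`, the pointers `b` and `c` together advance by at most
`r - s < n`, each advance weighing five, and the rank is at most four. -/
lemma StableTriple.lt_of_not_done (T : P.StableTriple s t r) {k : ℕ}
    (h : (P.config r s t k).phase ≠ .done) : k < 6 * n + 5 := by
  obtain ⟨a, b, c, I⟩ := T.exists_invariant k
  have := I.potential h
  have := I.a_lt; have := I.b_le; have := I.c_le; have := T.lt₁; have := T.lt₂; have := T.lt₃
  have : (P.config r s t k).phase.rank ≤ 4 := by
    cases (P.config r s t k).phase <;> simp [Phase.rank]
  omega

lemma StableTriple.exists_done (T : P.StableTriple s t r) :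
    ∃ N ≤ 6 * n + 5, (P.config r s t N).phase = .done := by
  by_contra! h
  exact lt_irrefl _ (T.lt_of_not_done (h _ le_rfl))

/-- The pointers `B` and `C` change only when the next phase is `scan`. -/
lemma phase_eq_scan_of_ne {T : Tests n} {r t : ZMod n} {σ : Config n}
    (h : ¬ ((step T r t σ).val.B = σ.B ∧ (step T r t σ).val.C = σ.C)) :
    (step T r t σ).val.phase = .scan := by
  obtain ⟨ph, A, B, C, out⟩ := σ
  cases ph with
  | killB => rfl
  | killC => rfl
  | done => exact (h ⟨rfl, rfl⟩).elim
  | scan =>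
    simp only [step, Timed.val_bind] at h ⊢
    split_ifs at h ⊢ <;> simp at h ⊢
  | report => exact (h ⟨by simp only [step, Timed.val_bind]; split_ifs <;> simp <;> split_ifs <;> rfl,
      by simp only [step, Timed.val_bind]; split_ifs <;> simp <;> split_ifs <;> rfl⟩).elim
  | check =>
    refine (h ?_).elim
    simp only [step, Timed.val_bind]
    split <;> exact ⟨rfl, rfl⟩
  | choose =>
    refine (h ?_).elim
    simp only [step, Timed.val_bind]
    split_ifs <;> exact ⟨rfl, rfl⟩

/-- An index in the arc from `i` to `j` other than `i` has a lift behind that of `i`. -/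
lemma exists_lift_of_mem_arc (P : ConvexPolygon n) {i j : ℤ} (h1 : i ≤ j) (h2 : j < i + n)
    {k : ZMod n} (hk : k ∈ arc (i : ZMod n) j) (hne : k ≠ i) :
    ∃ k' : ℤ, i < k' ∧ k' ≤ j ∧ (k' : ZMod n) = k := by
  obtain ⟨k', e1, e2, rfl⟩ := P.exists_lift k i
  have hk' : ((k' : ZMod n) - (i : ZMod n)).val ≤ ((j : ZMod n) - (i : ZMod n)).val := hk
  have := P.val_sub e1 e2
  have := P.val_sub h1 h2
  refine ⟨k', lt_of_le_of_ne e1 ?_, by omega, rfl⟩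
  rintro rfl
  exact hne rfl

lemma mem_arc (P : ConvexPolygon n) {i j k : ℤ} (h1 : i ≤ k) (h2 : k ≤ j) (h3 : j < i + n) :
    (k : ZMod n) ∈ arc (i : ZMod n) j := by
  change ((k : ZMod n) - (i : ZMod n)).val ≤ ((j : ZMod n) - (i : ZMod n)).val
  have := P.val_sub h1 (show k < i + n by omega)
  have := P.val_sub (show i ≤ j by omega) h3
  omega

/-- A pair of vertices that is not dead has a lift in a stable triple of integers. -/
lemma exists_stableTriple_of_not_dead {j k : ℤ} (h1 : j ≤ k) (h2 : k < j + n)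
    (h : ¬ P.Dead j k) : ∃ i, P.StableTriple j k i := by
  obtain ⟨i, hi⟩ := not_not.1 h
  obtain ⟨k', i', e, -, T⟩ := hi.exists_lift rfl
  have := T.lt₁; have := T.lt₂; have := T.lt₃
  obtain rfl := P.cast_inj e (by omega) (by omega)
  exact ⟨i', T⟩

end ConvexPolygon

end RotateAndKill

theorem mainTheorem1 :
    ∃ c : ℕ, ∀ (n : ℕ) (P : RotateAndKill.ConvexPolygon n) (r s t : ZMod n),
      P.ThreeStable r s t →
      -- when `B` is about to be killed, the pairs `(B, C + 1), …, (B, v_r)` are dead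
      (∀ k : ℕ, (P.config r s t k).phase = .killB →
        ∀ j ∈ RotateAndKill.arc (P.config r s t k).C r, j ≠ (P.config r s t k).C →
          P.Dead (P.config r s t k).B j) ∧
      -- when `C` is about to be killed, the pairs `(B + 1, C), …, (v_t, C)` are dead
      (∀ k : ℕ, (P.config r s t k).phase = .killC →
        ∀ j ∈ RotateAndKill.arc (P.config r s t k).B t, j ≠ (P.config r s t k).B →
          P.Dead j (P.config r s t k).C) ∧
      -- the pointers stay in their ranges and are distinct
      (∀ k : ℕ, (P.config r s t k).B ∈ RotateAndKill.arc s t ∧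
        (P.config r s t k).C ∈ RotateAndKill.arc t r ∧
        (P.config r s t k).B ≠ (P.config r s t k).C) ∧
      -- the arithmetic implementation goes through the same configurations
      (∀ k : ℕ, (RotateAndKill.run P.arithmeticTests r s t k).val = P.config r s t k) ∧
      ∃ M N : ℕ, M ≤ N ∧
        -- after `M` steps `(B, C)` becomes `(v_t, v_r)`, for the first time
        ((P.config r s t M).B = t ∧ (P.config r s t M).C = r ∧
          (P.config r s t M).phase = .scan ∧
          ∀ m < M, ¬ ((P.config r s t m).B = t ∧ (P.config r s t m).C = r)) ∧
        -- by then every 3-stable triangle is output, with one possible exception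
        (∀ i j k : ZMod n, P.ThreeStable i j k →
          RotateAndKill.Listed (P.config r s t M).out i j k ∨
          RotateAndKill.Listed [(s - 1, t, r)] i j k) ∧
        -- after `N` steps the process stops, still at `(v_t, v_r)`
        ((P.config r s t N).B = t ∧ (P.config r s t N).C = r ∧
          (P.config r s t N).phase = .done) ∧
        -- the triangles output are exactly the 3-stable ones
        (∀ i j k : ZMod n, P.ThreeStable i j k ↔
          RotateAndKill.Listed (P.config r s t N).out i j k) ∧
        -- the number of steps and of elementary operations is linear
        N ≤ c * n ∧ (RotateAndKill.run P.arithmeticTests r s t N).time ≤ c * n := by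
  -- There are at most `6 * n + 5` steps of at most `500` operations each, and `3000 * n + 2500 ≤
  -- 5000 * n` as `n ≥ 3`.
  refine ⟨5000, fun n P r s t h => ?_⟩
  obtain ⟨s, -, -, rfl⟩ := P.exists_lift s 0
  obtain ⟨t, r, rfl, rfl, T⟩ := h.exists_lift rfl
  have ht1 := T.lt₁
  have ht2 := T.lt₂
  have ht3 := T.lt₃
  refine ⟨fun k hk j hj hne => ?_, fun k hk j hj hne => ?_, fun k => ?_, T.run_arithmetic, ?_⟩
  · obtain ⟨a, b, c, I⟩ := T.exists_invariant k
    have := I.le_b; have := I.b_le; have := I.le_c; have := I.c_le; have := I.b_lt_c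
    rw [I.C_eq] at hj hne
    obtain ⟨j, h1, h2, rfl⟩ := P.exists_lift_of_mem_arc I.c_le (by omega) hj hne
    rw [I.B_eq]
    by_contra hd
    obtain ⟨i, T'⟩ := RotateAndKill.ConvexPolygon.exists_stableTriple_of_not_dead (by omega)
      (by omega) hd
    exact I.dead_of_killB T hk h1 T'
  · obtain ⟨a, b, c, I⟩ := T.exists_invariant k
    have := I.le_b; have := I.b_le; have := I.le_c; have := I.c_le; have := I.b_lt_c
    rw [I.B_eq] at hj hne
    obtain ⟨j, h1, h2, rfl⟩ := P.exists_lift_of_mem_arc I.b_le (by omega) hj hne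
    rw [I.C_eq]
    by_contra hd
    obtain ⟨i, T'⟩ := RotateAndKill.ConvexPolygon.exists_stableTriple_of_not_dead (by omega)
      (by omega) hd
    exact I.dead_of_killC T hk h1 h2 T'
  · obtain ⟨a, b, c, I⟩ := T.exists_invariant k
    have := I.le_b; have := I.b_le; have := I.le_c; have := I.c_le; have := I.b_lt_c
    rw [I.B_eq, I.C_eq]
    refine ⟨P.mem_arc I.le_b I.b_le (by omega), P.mem_arc I.le_c I.c_le (by omega), fun e => ?_⟩
    have := P.cast_inj e (by omega) (by omega)
    omega
  obtain ⟨N, hN, hd⟩ := T.exists_done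
  obtain ⟨a, b, c, I⟩ := T.exists_invariant N
  obtain ⟨rfl, rfl⟩ := I.at_end hd
  have hex : ∃ M, (P.config c s b M).B = b ∧ (P.config c s b M).C = c := ⟨N, I.B_eq, I.C_eq⟩
  classical
  obtain ⟨M, ⟨hMB, hMC⟩, hmin⟩ : ∃ M, ((P.config c s b M).B = b ∧ (P.config c s b M).C = c) ∧
      ∀ m < M, ¬ ((P.config c s b m).B = b ∧ (P.config c s b m).C = c) :=
    ⟨Nat.find hex, Nat.find_spec hex, fun m hm => Nat.find_min hex hm⟩
  have hn := P.three_le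
  refine ⟨M, N, not_lt.1 fun hlt => hmin N hlt ⟨I.B_eq, I.C_eq⟩, ⟨hMB, hMC, ?_, hmin⟩,
    fun i j k hT => ?_, ⟨I.B_eq, I.C_eq, hd⟩, fun i j k => ⟨I.listed_of_done T hd, ?_⟩, by omega, ?_⟩
  · cases M with
    | zero => rfl
    | succ m =>
      have := hmin m (Nat.lt_succ_self m)
      rw [P.config_succ] at hMB hMC ⊢
      exact RotateAndKill.ConvexPolygon.phase_eq_scan_of_ne fun e => this ⟨e.1 ▸ hMB, e.2 ▸ hMC⟩
  · obtain ⟨a', b', c', J⟩ := T.exists_invariant M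
    have := J.le_b; have := J.b_le; have := J.le_c; have := J.c_le
    rw [J.B_eq] at hMB
    rw [J.C_eq] at hMC
    exact J.listed_or T (P.cast_inj hMB (by omega) (by omega))
      (P.cast_inj hMC (by omega) (by omega)) hT
  · rintro (h' | h' | h')
    exacts [I.sound _ h', (I.sound _ h').rotate.rotate, (I.sound _ h').rotate]
  · have := P.time_run_le c s b N
    omega
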